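/- **Setting.** Let $d\in\{2,3\}$ and let $\Omega\subset\mathbb R^d$ be a bounded convex domain with a finite conforming partition $\mathcal T_h$ of $\overline\Omega$, either into nondegenerate $d$-simplices or into axis-parallel boxes (any two closed cells meet in a common face or not at all). Let $X_h$ be the space of continuous vector fields on $\overline\Omega$ whose components are polynomials of total degree $\le 2$ on each cell. Let $\mathbf{RM}=\{x\mapsto a+Bx:\ a\in\mathbb R^d,\ B\in\mathbb R^{d\times d},\ B^T=-B\}$ be the rigid motions, and put $$V_h=\{v\in X_h:(v,r)=0\ \ \forall r\in\mathbf{RM}\},\qquad M_h=W_h=\{q\in C^0(\overline\Omega): q|_{\mathcal K}\in P_1\ \ \forall \mathcal K\in\mathcal T_h\}.$$ Here $(\cdot,\cdot)$ and $\langle\cdot,\cdot\rangle$ are the $L^2(\Omega)$ and $L^2(\partial\Omega)$ inner products. **Coefficients.** Let $\lambda,\mu,\alpha,\mu_f>0$, $c_0\ge 0$, $\rho_f\in\mathbb R$, $\mathbf g\in L^2(\Omega)^d$. Let $K$ be a measurable symmetric matrix field with $K_1|\zeta|^2\le K(x)\zeta\cdot\zeta\le K_2|\zeta|^2$ for a.e.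 $x\in\Omega$ and all $\zeta\in\mathbb R^d$, where $K_1,K_2>0$ are constants. Let $\kappa$ be continuous on $\Omega$ with $0<k_0\le\kappa\le k_1$. Let $\Phi\in C^2([0,\infty))$ and let $C_1,C_2,C_3>0$ be constants such that, for all $\rho\ge 0$ and $x\in\Omega$, $$C_1\le\mu\Phi'(\rho)<\kappa(x),\qquad |\rho\Phi''(\rho)|\le C_2,\qquad \Phi'(\rho)+2\rho\Phi''(\rho)\ge C_3 .$$ Assume that $\lambda$ is large enough that $1/\lambda<k_0$. Put $$\kappa_1=\frac{\lambda\alpha}{\lambda\alpha^2+c_0},\qquad \kappa_2=\frac1{\lambda\alpha^2+c_0},\qquad \kappa_3=\frac{\lambda c_0}{\lambda\alpha^2+c_0}.$$ With $\varepsilon(u)=\frac12(\nabla u+\nabla u^T)$ and $\mathrm{dev}(\tau)=\mathrm{tr}(\tau^2)-\frac1d\mathrm{tr}(\tau)^2$, let $$\sigma(u)=\bigl(\kappa-\tfrac{2}{d}\mu\Phi'(\mathrm{dev}\,\varepsilon(u))\bigr)(\operatorname{div}u)\,I+2\mu\Phi'(\mathrm{dev}\,\varepsilon(u))\,\varepsilon(u),\qquad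 \mathcal N(\varepsilon(u))=\sigma(u)-\tfrac1\lambda(\operatorname{div}u)\,I .$$ **Scheme.** Let $T>0$, $N\ge1$, $\Delta t=T/N$, $t_n=n\Delta t$ and $\theta\in\{0,1\}$. For every $t\in(0,T]$ let $\mathbf f(t)\in L^2(\Omega)^d$, $\mathbf f_1(t)\in L^2(\partial\Omega)^d$, $\phi(t)\in L^2(\Omega)$ and $\phi_1(t)\in L^2(\partial\Omega)$. The step from $n$ to $n+1$ ($0\le n<N$) asks, for given $\eta_h^n\in W_h$, for $(u_h^{n+1},\xi_h^{n+1},\eta_h^{n+1})\in V_h\times M_h\times W_h$ such that, with the sources taken at $t_{n+1}$, $$(\mathcal N(\varepsilon(u_h^{n+1})),\varepsilon(v))-(\xi_h^{n+1},\operatorname{div}v)=(\mathbf f,v)+\langle\mathbf f_1,v\rangle\qquad\forall v\in V_h,$$ $$\kappa_3(\xi_h^{n+1},\varphi)+(\operatorname{div}u_h^{n+1},\varphi)=\kappa_1(\eta_h^{n+\theta},\varphi)\qquad\forall\varphi\in M_h,$$ $$\Bigl(\frac{\eta_h^{n+1}-\eta_h^n}{\Delta t},\psi\Bigr)+\frac1{\mu_f}\bigl(K(\nabla(\kappa_1\xi_h^{n+1}+\kappa_2\eta_h^{n+1})-\rho_f\mathbf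 g),\nabla\psi\bigr)=(\phi,\psi)+\langle\phi_1,\psi\rangle\qquad\forall\psi\in M_h.$$ **Theorem.** For every $0\le n<N$ and every $\eta_h^n\in W_h$ the step has exactly one solution $(u_h^{n+1},\xi_h^{n+1},\eta_h^{n+1})\in V_h\times M_h\times W_h$. Consequently, for every starting value $\eta_h^0\in W_h$ the numerical solution $\{(u_h^{n+1},\xi_h^{n+1},\eta_h^{n+1})\}_{0\le n<N}$ exists and is unique. -/

import Mathlib

open MeasureTheory Set

noncomputable section

namespace Poro

/-- Euclidean space `ℝ^d`. -/
abbrev E (d : ℕ) := EuclideanSpace ℝ (Fin d)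

/-! ### Differential operators on (piecewise smooth) functions -/

/-- The gradient `(∇q)_j = ∂q/∂x_j`. For a continuous piecewise polynomial function it is defined
in the interior of every cell, hence almost everywhere, and it is the weak gradient. -/
def grad {d : ℕ} (q : E d → ℝ) (x : E d) : Fin d → ℝ :=
  fun j => fderiv ℝ q x (EuclideanSpace.single j 1)

/-- The Jacobian matrix `(∇u)_{ij} = ∂u_i/∂x_j`. -/
def jac {d : ℕ} (u : E d → E d) (x : E d) : Matrix (Fin d) (Fin d) ℝ :=
  Matrix.of fun i j => (fderiv ℝ u x (EuclideanSpace.single j 1)) i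

/-- The divergence `div u = ∑ i, ∂u_i/∂x_i`. -/
def divg {d : ℕ} (u : E d → E d) (x : E d) : ℝ := (jac u x).trace

/-- The linearised strain `ε(u) = (∇u + ∇uᵀ)/2`. -/
def strain {d : ℕ} (u : E d → E d) (x : E d) : Matrix (Fin d) (Fin d) ℝ :=
  (1 / 2 : ℝ) • (jac u x + (jac u x).transpose)

/-- The Frobenius product `A : B = ∑ i j, A_{ij} B_{ij}`. -/
def frob {d : ℕ} (A B : Matrix (Fin d) (Fin d) ℝ) : ℝ := ∑ i, ∑ j, A i j * B i j

/-! ### Material data and the Hencky–Mises law -/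

/-- The coefficients of the poroelastic model. -/
structure Material (d : ℕ) where
  /-- Lamé constant `λ` -/
  lam : ℝ
  /-- Lamé constant `μ` -/
  mu : ℝ
  /-- Biot–Willis constant -/
  alpha : ℝ
  /-- constrained specific storage coefficient -/
  c0 : ℝ
  /-- fluid viscosity -/
  muf : ℝ
  /-- fluid density -/
  rhof : ℝ
  /-- gravitational acceleration -/
  g : E d → E d
  /-- the coefficient `κ` of the stored energy density -/
  kappa : E d → ℝ
  /-- the function `Φ` of the stored energy density; only its values on `[0, ∞)` matter -/
  Phi : ℝ → ℝ
  /-- the permeability tensor -/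
  K : E d → Matrix (Fin d) (Fin d) ℝ

namespace Material

variable {d : ℕ}

/-- `Φ'` on `[0, ∞)` (one-sided at `0`). -/
def dPhi (m : Material d) (r : ℝ) : ℝ := derivWithin m.Phi (Ici 0) r

/-- `Φ''` on `[0, ∞)` (one-sided at `0`). -/
def ddPhi (m : Material d) (r : ℝ) : ℝ := derivWithin m.dPhi (Ici 0) r

/-- The standing assumptions on the coefficients. -/
structure IsAdmissible (m : Material d) (Ω : Set (E d)) : Prop where
  lam_pos : 0 < m.lam
  mu_pos : 0 < m.mu
  alpha_pos : 0 < m.alpha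
  c0_nonneg : 0 ≤ m.c0
  muf_pos : 0 < m.muf
  g_memLp : MemLp m.g 2 (volume.restrict Ω)
  kappa_cont : ContinuousOn m.kappa Ω
  /-- `0 < k₀ ≤ κ ≤ k₁`, and `λ` is large enough: `1/λ < k₀`. -/
  kappa_bounds : ∃ k₀ k₁ : ℝ, 0 < k₀ ∧ 1 / m.lam < k₀ ∧ ∀ x ∈ Ω, k₀ ≤ m.kappa x ∧ m.kappa x ≤ k₁
  Phi_smooth : ContDiffOn ℝ 2 m.Phi (Ici 0)
  Phi_bounds : ∃ C₁ C₂ C₃ : ℝ, 0 < C₁ ∧ 0 < C₂ ∧ 0 < C₃ ∧ ∀ r : ℝ, 0 ≤ r →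
    C₁ ≤ m.mu * m.dPhi r ∧ (∀ x ∈ Ω, m.mu * m.dPhi r < m.kappa x) ∧
    |r * m.ddPhi r| ≤ C₂ ∧ C₃ ≤ m.dPhi r + 2 * r * m.ddPhi r
  K_meas : ∀ i j, AEMeasurable (fun x => m.K x i j) (volume.restrict Ω)
  K_symm : ∀ᵐ x ∂(volume.restrict Ω), (m.K x).IsSymm
  K_bounds : ∃ K₁ K₂ : ℝ, 0 < K₁ ∧ 0 < K₂ ∧ ∀ᵐ x ∂(volume.restrict Ω), ∀ z : Fin d → ℝ,
    K₁ * (z ⬝ᵥ z) ≤ (m.K x).mulVec z ⬝ᵥ z ∧ (m.K x).mulVec z ⬝ᵥ z ≤ K₂ * (z ⬝ᵥ z)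

/-- `κ₁ = λα / (λα² + c₀)`. -/
def kap1 (m : Material d) : ℝ := m.lam * m.alpha / (m.lam * m.alpha ^ 2 + m.c0)

/-- `κ₂ = 1 / (λα² + c₀)`. -/
def kap2 (m : Material d) : ℝ := 1 / (m.lam * m.alpha ^ 2 + m.c0)

/-- `κ₃ = λc₀ / (λα² + c₀)`. -/
def kap3 (m : Material d) : ℝ := m.lam * m.c0 / (m.lam * m.alpha ^ 2 + m.c0)

end Material

/-- `dev τ = tr(τ²) - tr(τ)²/d`; for `d = 2` this is `tr(τ²) - tr(τ)²/2`. It is nonnegative on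
symmetric matrices, being the squared Frobenius norm of the trace-free part of `τ`. -/
def dev {d : ℕ} (τ : Matrix (Fin d) (Fin d) ℝ) : ℝ := (τ * τ).trace - 1 / (d : ℝ) * τ.trace ^ 2

namespace Material

variable {d : ℕ}

/-- The nonlinear Lamé function `μ̃(ρ) = 2 μ Φ'(ρ)`. -/
def muT (m : Material d) (r : ℝ) : ℝ := 2 * m.mu * m.dPhi r

/-- The nonlinear Lamé function `λ̃(ρ) = κ - μ̃(ρ)/d`. -/
def lamT (m : Material d) (x : E d) (r : ℝ) : ℝ := m.kappa x - 1 / (d : ℝ) * m.muT r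

/-- The Hencky–Mises stress `σ = λ̃(dev τ) tr(τ) I + μ̃(dev τ) τ` for the strain `τ` at `x`. It is
the derivative of `κ/2 tr(τ)² + μ Φ(dev τ)`. -/
def stress (m : Material d) (x : E d) (τ : Matrix (Fin d) (Fin d) ℝ) :
    Matrix (Fin d) (Fin d) ℝ :=
  (m.lamT x (dev τ) * τ.trace) • (1 : Matrix (Fin d) (Fin d) ℝ) + m.muT (dev τ) • τ

/-- `𝒩(ε(u)) = σ(u) - (1/λ) (div u) I`, at the point `x`. -/
def Nop (m : Material d) (u : E d → E d) (x : E d) : Matrix (Fin d) (Fin d) ℝ :=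
  m.stress x (strain u x) - (1 / m.lam * divg u x) • (1 : Matrix (Fin d) (Fin d) ℝ)

end Material

/-! ### Meshes. A cell is given by the finite set of its vertices, the closed cell is their
convex hull. -/

/-- The closed cells cover `closure Ω`, and two cells meet in the convex hull of their common
vertices (a common face, or nothing). -/
structure IsConformingMesh {d : ℕ} (Ω : Set (E d)) (T : Finset (Finset (E d))) : Prop where
  cover : (⋃ k ∈ T, convexHull ℝ (k : Set (E d))) = closure Ω
  conforming : ∀ k ∈ T, ∀ l ∈ T, convexHull ℝ (k : Set (E d)) ∩ convexHull ℝ (l : Set (E d)) =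
    convexHull ℝ ((k : Set (E d)) ∩ (l : Set (E d)))

/-- The vertex set of a nondegenerate `d`-simplex. -/
def IsSimplexCell {d : ℕ} (k : Finset (E d)) : Prop :=
  k.card = d + 1 ∧ AffineIndependent ℝ ((↑) : k → E d)

/-- The vertex set of a nondegenerate axis-parallel box `∏ i, [a_i, b_i]`. -/
def IsBoxCell {d : ℕ} (k : Finset (E d)) : Prop :=
  ∃ a b : E d, (∀ i, a i < b i) ∧ ∀ x : E d, x ∈ k ↔ ∀ i, x i = a i ∨ x i = b i

/-- A triangulation of `Ω` or a rectangular partition of `Ω`. -/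
def IsPartition {d : ℕ} (Ω : Set (E d)) (T : Finset (Finset (E d))) : Prop :=
  IsConformingMesh Ω T ∧ ((∀ k ∈ T, IsSimplexCell k) ∨ (∀ k ∈ T, IsBoxCell k))

/-! ### Finite element spaces. Functions on `closure Ω` are represented by functions on `ℝ^d` that
vanish outside of `closure Ω`. -/

/-- Continuous functions on `closure Ω` whose restriction to every closed cell is a polynomial of
total degree at most `r`. -/
def lagrange {d : ℕ} (Ω : Set (E d)) (T : Finset (Finset (E d))) (r : ℕ) : Set (E d → ℝ) :=
  {q | ContinuousOn q (closure Ω) ∧ (∀ x ∉ closure Ω, q x = 0) ∧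
    ∀ k ∈ T, ∃ p : MvPolynomial (Fin d) ℝ, p.totalDegree ≤ r ∧
      ∀ x ∈ convexHull ℝ (k : Set (E d)), q x = MvPolynomial.eval (fun i => x i) p}

/-- The infinitesimal rigid motions `x ↦ a + B x` with `B` skew-symmetric
(`a + b × x` for `d = 3`). -/
def rigidMotions (d : ℕ) : Set (E d → E d) :=
  {r | ∃ (a : E d) (B : Matrix (Fin d) (Fin d) ℝ), B.transpose = -B ∧
    ∀ x i, r x i = a i + B.mulVec (fun j => x j) i}

/-- `X_h`: continuous piecewise quadratic vector fields (they are automatically in `H¹(Ω)`). -/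
def Xh {d : ℕ} (Ω : Set (E d)) (T : Finset (Finset (E d))) : Set (E d → E d) :=
  {v | ∀ i, (fun x => v x i) ∈ lagrange Ω T 2}

/-- `V_h`: the elements of `X_h` that are `L²`-orthogonal to the rigid motions. -/
def Vh {d : ℕ} (Ω : Set (E d)) (T : Finset (Finset (E d))) : Set (E d → E d) :=
  {v | v ∈ Xh Ω T ∧ ∀ r ∈ rigidMotions d, ∫ x in Ω, inner ℝ (v x) (r x) = 0}

/-- `M_h`: continuous piecewise linear functions. -/
def Mh {d : ℕ} (Ω : Set (E d)) (T : Finset (Finset (E d))) : Set (E d → ℝ) := lagrange Ω T 1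

/-- `W_h`, chosen equal to `M_h`. -/
def Wh {d : ℕ} (Ω : Set (E d)) (T : Finset (Finset (E d))) : Set (E d → ℝ) := Mh Ω T

/-! ### The discrete scheme -/

/-- Body force `f`, traction `f₁`, source `φ` and boundary flux `φ₁`, all time-dependent. -/
structure Sources (d : ℕ) where
  f : ℝ → E d → E d
  f1 : ℝ → E d → E d
  phi : ℝ → E d → ℝ
  phi1 : ℝ → E d → ℝ

/-- The surface measure on `∂Ω`. -/
def surf {d : ℕ} (Ω : Set (E d)) : Measure (E d) :=
  (Measure.euclideanHausdorffMeasure (d - 1)).restrict (frontier Ω)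

/-- At each time in `(0, T]` the sources are square integrable on `Ω`, respectively on `∂Ω`. -/
structure Sources.IsAdmissible {d : ℕ} (s : Sources d) (Ω : Set (E d)) (T : ℝ) : Prop where
  f_memLp : ∀ t ∈ Ioc 0 T, MemLp (s.f t) 2 (volume.restrict Ω)
  f1_memLp : ∀ t ∈ Ioc 0 T, MemLp (s.f1 t) 2 (surf Ω)
  phi_memLp : ∀ t ∈ Ioc 0 T, MemLp (s.phi t) 2 (volume.restrict Ω)
  phi1_memLp : ∀ t ∈ Ioc 0 T, MemLp (s.phi1 t) 2 (surf Ω)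

/-- `(u, ξ, η) ∈ V_h × M_h × W_h` solves the three equations of one time step of length `dt`, with
new time level `t`. Here `ηold` and `η` are the old and new time levels of the third variable, and
the second equation uses `ηold` if `θ = 0` and `η` if `θ = 1`. -/
structure IsStepSolution {d : ℕ} (m : Material d) (s : Sources d) (Ω : Set (E d))
    (T : Finset (Finset (E d))) (θ : Fin 2) (dt t : ℝ) (ηold : E d → ℝ)
    (u : E d → E d) (ξ η : E d → ℝ) : Prop where
  u_mem : u ∈ Vh Ω T
  ξ_mem : ξ ∈ Mh Ω T
  η_mem : η ∈ Wh Ω T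
  momentum : ∀ v ∈ Vh Ω T,
    (∫ x in Ω, frob (m.Nop u x) (strain v x)) - ∫ x in Ω, ξ x * divg v x =
      (∫ x in Ω, inner ℝ (s.f t x) (v x)) + ∫ x, inner ℝ (s.f1 t x) (v x) ∂(surf Ω)
  constraint : ∀ q ∈ Mh Ω T,
    m.kap3 * (∫ x in Ω, ξ x * q x) + ∫ x in Ω, divg u x * q x =
      m.kap1 * ∫ x in Ω, (if θ = 0 then ηold x else η x) * q x
  diffusion : ∀ ψ ∈ Mh Ω T,
    (∫ x in Ω, (η x - ηold x) / dt * ψ x) +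
      1 / m.muf * (∫ x in Ω, (m.K x).mulVec
        (grad (fun y => m.kap1 * ξ y + m.kap2 * η y) x - m.rhof • fun i => m.g x i) ⬝ᵥ grad ψ x) =
      (∫ x in Ω, s.phi t x * ψ x) + ∫ x, s.phi1 t x * ψ x ∂(surf Ω)

end Poro

end

/-! One time step is a nonlinear saddle point problem in finite dimension. Three facts make it
uniquely solvable.

Monotonicity. Split the strain `ε` into trace and deviatoric part `ε^D`. Then `𝒩(ε) = (κ - 1/λ)
tr(ε) I + 2μΦ'(|ε^D|²) ε^D`, and the two terms are Frobenius-orthogonal. The first is monotone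
because `1/λ < k₀`. The second is a radial map, governed by the scalar function `s ↦ s Φ'(s²)`,
whose derivative `Φ' + 2ρΦ''` at `ρ = s²` lies between `C₃` and a finite bound. Hence `𝒩` is
strongly monotone and Lipschitz on `L²` (`exists_stress_operator`).

Rigidity. A discrete field with zero strain is a rigid motion, so it vanishes in `V_h`
(`eq_zero_of_strain_eq_zero`). No Korn constant is needed, since `V_h` is normed by the strain
itself.

Divergence. If `q ∈ M_h` is orthogonal to `div V_h`, test with `q (x - x₀)`, which is piecewise
quadratic, minus a rigid motion, which has no divergence. Formally `∫ q div(q (x - x₀)) = d/2 ∫ q² +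
1/2 ∫_{∂Ω} q² (x - x₀)·n`, and the flux is nonnegative on a convex domain, so `q = 0`
(`eq_zero_of_forall_integral_divg_eq_zero`). Finite dimension makes this injectivity sufficient; no
uniform inf-sup constant enters.

The abstract saddle point problem is solved by eliminating `u`: the Schur complement is again
strongly monotone and Lipschitz, hence bijective by Banach's fixed point theorem
(`saddle_existsUnique`). For `θ = 0` one solves for `(u, ξ)` and then for `η`. For `θ = 1` the pair
`(ξ, η)` acts as one multiplier, and a suitable choice of test functions cancels the indefinite
coupling (`step_forms_existsUnique`). -/

/-! ### Monotone operators and abstract saddle point problems. -/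

/-- A strongly monotone Lipschitz map of a Hilbert space is bijective. -/
theorem bijective_of_strongly_monotone {H : Type*} [NormedAddCommGroup H] [InnerProductSpace ℝ H]
    [CompleteSpace H] (A : H → H) {γ L : ℝ} (hγ : 0 < γ)
    (hmono : ∀ x y, γ * ‖x - y‖ ^ 2 ≤ inner ℝ (A x - A y) (x - y))
    (hlip : ∀ x y, ‖A x - A y‖ ≤ L * ‖x - y‖) : Function.Bijective A := by
  constructor
  · intro x y hxy
    have h := hmono x y
    rw [hxy, sub_self, inner_zero_left] at h
    have h2 : ‖x - y‖ ^ 2 ≤ 0 := by nlinarith [sq_nonneg ‖x - y‖]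
    exact sub_eq_zero.mp (norm_eq_zero.mp (pow_eq_zero_iff two_ne_zero |>.mp
      (le_antisymm h2 (sq_nonneg _))))
  · intro b
    -- `M` is a Lipschitz constant that is positive and exceeds `γ`, whatever the sign of `L`. The
    -- step `t = γ / M²` minimises `1 - 2tγ + t²M²`, the bound for the squared contraction factor of
    -- `x ↦ x - t (A x - b)`; the minimum is `q`.
    set M : ℝ := max L γ + 1 with hM
    have hMγ : γ < M := by linarith [le_max_right L γ]
    have hML : L ≤ M := by linarith [le_max_left L γ]
    have hM0 : 0 < M := hγ.trans hMγ
    set t : ℝ := γ / M ^ 2 with ht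
    have ht0 : 0 < t := by positivity
    set q : ℝ := 1 - γ ^ 2 / M ^ 2 with hq
    have hq1 : q < 1 := by have : 0 < γ ^ 2 / M ^ 2 := by positivity
                           linarith
    have hq0 : 0 < q := by
      have : γ ^ 2 / M ^ 2 < 1 := by rw [div_lt_one (by positivity)]; gcongr
      linarith
    let F : H → H := fun x => x - t • (A x - b)
    have hF : ∀ x y, ‖F x - F y‖ ^ 2 ≤ q * ‖x - y‖ ^ 2 := by
      intro x y
      have e : F x - F y = (x - y) - t • (A x - A y) := by simp only [F]; module
      have hl : ‖A x - A y‖ ^ 2 ≤ M ^ 2 * ‖x - y‖ ^ 2 := by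
        rw [← mul_pow]
        exact pow_le_pow_left₀ (norm_nonneg _)
          ((hlip x y).trans (mul_le_mul_of_nonneg_right hML (norm_nonneg _))) 2
      rw [e, norm_sub_sq_real, inner_smul_right, norm_smul, mul_pow, Real.norm_of_nonneg ht0.le,
        real_inner_comm]
      have h1 := mul_le_mul_of_nonneg_left (hmono x y) ht0.le
      have h2 := mul_le_mul_of_nonneg_left hl (sq_nonneg t)
      have h3 : t * γ = γ ^ 2 / M ^ 2 := by rw [ht]; ring
      have h4 : t ^ 2 * M ^ 2 = γ ^ 2 / M ^ 2 := by rw [ht]; field_simp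
      rw [← mul_assoc, h3] at h1
      rw [← mul_assoc, h4] at h2
      rw [hq]
      linarith
    have hc : ContractingWith (Real.toNNReal (Real.sqrt q)) F := by
      refine ⟨?_, LipschitzWith.of_dist_le_mul fun x y => ?_⟩
      · rw [Real.toNNReal_lt_one]
        exact (Real.sqrt_lt' one_pos).mpr (by simpa using hq1)
      · rw [Real.coe_toNNReal _ (Real.sqrt_nonneg _), dist_eq_norm, dist_eq_norm]
        refine le_of_sq_le_sq ?_ (by positivity)
        rw [mul_pow, Real.sq_sqrt hq0.le]
        exact hF x y
    refine ⟨hc.fixedPoint F, ?_⟩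
    have h := hc.fixedPoint_isFixedPt
    have h1 : t • (A (hc.fixedPoint F) - b) = 0 := by
      have h2 : hc.fixedPoint F - t • (A (hc.fixedPoint F) - b) = hc.fixedPoint F := h
      simpa using h2
    exact sub_eq_zero.mp ((smul_eq_zero.mp h1).resolve_left ht0.ne')

/-- A positive definite quadratic form on a finite-dimensional space is coercive. -/
theorem exists_coercive_of_pos {Q : Type*} [NormedAddCommGroup Q] [InnerProductSpace ℝ Q]
    [FiniteDimensional ℝ Q] (φ : Q → ℝ) (hφ : Continuous φ)
    (hsmul : ∀ (r : ℝ) w, φ (r • w) = r ^ 2 * φ w) (hpos : ∀ w, w ≠ 0 → 0 < φ w) :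
    ∃ c : ℝ, 0 < c ∧ ∀ w, c * ‖w‖ ^ 2 ≤ φ w := by
  have : ProperSpace Q := FiniteDimensional.proper ℝ Q
  by_cases hne : (Metric.sphere (0 : Q) 1).Nonempty
  · obtain ⟨w₀, hw₀, hmin⟩ := (isCompact_sphere (0 : Q) 1).exists_isMinOn hne hφ.continuousOn
    have hw0 : w₀ ≠ 0 := by
      rintro rfl
      simp at hw₀
    refine ⟨φ w₀, hpos _ hw0, fun w => ?_⟩
    by_cases hw : w = 0
    · subst hw
      have := hsmul 0 0
      simp at this
      simp [this]
    · have hn : ‖w‖ ≠ 0 := norm_ne_zero_iff.mpr hw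
      have h1 : φ w₀ ≤ φ (‖w‖⁻¹ • w) := hmin (by simp [norm_smul, hn])
      rw [hsmul] at h1
      have h2 := mul_le_mul_of_nonneg_right h1 (sq_nonneg ‖w‖)
      have h3 : ‖w‖⁻¹ ^ 2 * φ w * ‖w‖ ^ 2 = φ w := by field_simp
      linarith
  · refine ⟨1, one_pos, fun w => ?_⟩
    have hw : w = 0 := by
      by_contra hw
      exact hne ⟨‖w‖⁻¹ • w, by simp [norm_smul, norm_ne_zero_iff.mpr hw]⟩
    subst hw
    have := hsmul 0 0
    simp at this
    simp [this]

/-- A nonlinear saddle point problem on finite-dimensional inner product spaces. -/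
theorem saddle_existsUnique {V Q : Type*} [NormedAddCommGroup V] [InnerProductSpace ℝ V]
    [FiniteDimensional ℝ V] [NormedAddCommGroup Q] [InnerProductSpace ℝ Q] [FiniteDimensional ℝ Q]
    (A : V → V) {γ L : ℝ} (hγ : 0 < γ)
    (hmono : ∀ x y, γ * ‖x - y‖ ^ 2 ≤ inner ℝ (A x - A y) (x - y))
    (hlip : ∀ x y, ‖A x - A y‖ ≤ L * ‖x - y‖)
    (β : Q →L[ℝ] V) (C : Q →L[ℝ] Q) (hC : ∀ w, 0 ≤ inner ℝ (C w) w)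
    (hpd : ∀ w, β w = 0 → inner ℝ (C w) w = 0 → w = 0) (f : V) (g : Q) :
    ∃! p : V × Q, A p.1 - β p.2 = f ∧ ContinuousLinearMap.adjoint β p.1 + C p.2 = g := by
  have : CompleteSpace V := FiniteDimensional.complete ℝ V
  have : CompleteSpace Q := FiniteDimensional.complete ℝ Q
  have hbij := bijective_of_strongly_monotone A hγ hmono hlip
  let e := Equiv.ofBijective A hbij
  have hAe : ∀ x, A (e.symm x) = x := fun x => Equiv.ofBijective_apply_symm_apply A hbij x
  have heA : ∀ x, e.symm (A x) = x := fun x => Equiv.ofBijective_symm_apply_apply A hbij x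
  set M : ℝ := max L 1 with hM
  have hM1 : 1 ≤ M := le_max_right _ _
  have hlip' : ∀ x y, ‖x - y‖ ≤ M * ‖e.symm x - e.symm y‖ := fun x y => by
    have h := hlip (e.symm x) (e.symm y)
    rw [hAe, hAe] at h
    exact h.trans (mul_le_mul_of_nonneg_right (le_max_left _ _) (norm_nonneg _))
  -- The inverse inherits strong monotonicity: monotonicity of `A` bounds the pairing below by `γ`
  -- times the squared distance of the preimages, and the Lipschitz bound compares that distance
  -- with `‖x - y‖`.
  have hmono' : ∀ x y, γ / M ^ 2 * ‖x - y‖ ^ 2 ≤ inner ℝ (e.symm x - e.symm y) (x - y) := by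
    intro x y
    have h := hmono (e.symm x) (e.symm y)
    rw [hAe, hAe, real_inner_comm] at h
    refine le_trans ?_ h
    have h2 : ‖x - y‖ ^ 2 ≤ M ^ 2 * ‖e.symm x - e.symm y‖ ^ 2 := by
      rw [← mul_pow]; exact pow_le_pow_left₀ (norm_nonneg _) (hlip' x y) 2
    rw [div_mul_eq_mul_div, div_le_iff₀ (by positivity)]
    nlinarith
  have hlip'' : ∀ x y, ‖e.symm x - e.symm y‖ ≤ γ⁻¹ * ‖x - y‖ := by
    intro x y
    have h := hmono (e.symm x) (e.symm y)
    rw [hAe, hAe] at h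
    have h2 := h.trans (real_inner_le_norm _ _)
    rw [inv_mul_eq_div, le_div_iff₀ hγ]
    by_cases h0 : ‖e.symm x - e.symm y‖ = 0
    · rw [h0]; simp
    · have : 0 < ‖e.symm x - e.symm y‖ := lt_of_le_of_ne (norm_nonneg _) (Ne.symm h0)
      nlinarith
  -- This quadratic form bounds the monotonicity of the Schur complement `S` from below; `hpd` says
  -- exactly that it is definite.
  obtain ⟨c, hc, hcoer⟩ := exists_coercive_of_pos
    (fun w => γ / M ^ 2 * ‖β w‖ ^ 2 + inner ℝ (C w) w) (by fun_prop)
    (fun r w => by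
      simp only [map_smul, norm_smul, inner_smul_left, inner_smul_right, mul_pow,
        Real.norm_eq_abs, sq_abs]
      simp only [conj_trivial]
      ring)
    (fun w hw => by
      have h1 : 0 ≤ γ / M ^ 2 * ‖β w‖ ^ 2 := by positivity
      have h2 := hC w
      rcases h1.lt_or_eq with h | h
      · exact add_pos_of_pos_of_nonneg h h2
      · rcases h2.lt_or_eq with h' | h'
        · exact add_pos_of_nonneg_of_pos h1 h'
        · refine absurd (hpd w ?_ h'.symm) hw
          have h3 : γ / M ^ 2 ≠ 0 := by positivity
          have h4 : ‖β w‖ ^ 2 = 0 := (mul_eq_zero.mp h.symm).resolve_left h3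
          exact norm_eq_zero.mp (pow_eq_zero_iff two_ne_zero |>.mp h4))
  -- The first equation gives `u = A⁻¹(f + β w)`; inserting this in the second leaves `S w = g`.
  let S : Q → Q := fun w => ContinuousLinearMap.adjoint β (e.symm (f + β w)) + C w
  have hSsub : ∀ x y, S x - S y =
      ContinuousLinearMap.adjoint β (e.symm (f + β x) - e.symm (f + β y)) + C (x - y) := by
    intro x y
    simp only [S, map_sub]
    abel
  have hSbij : Function.Bijective S := by
    refine bijective_of_strongly_monotone S (L := ‖β‖ * (γ⁻¹ * ‖β‖) + ‖C‖) hc (fun x y => ?_)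
      fun x y => ?_
    · refine (hcoer (x - y)).trans ?_
      rw [hSsub, inner_add_left, ContinuousLinearMap.adjoint_inner_left]
      have h := hmono' (f + β x) (f + β y)
      rw [add_sub_add_left_eq_sub, ← map_sub] at h
      linarith
    · rw [hSsub]
      refine (norm_add_le _ _).trans ?_
      rw [add_mul]
      gcongr
      · refine (ContinuousLinearMap.le_opNorm _ _).trans ?_
        rw [LinearIsometryEquiv.norm_map, mul_assoc]
        gcongr
        refine (hlip'' _ _).trans ?_
        rw [add_sub_add_left_eq_sub, ← map_sub, mul_assoc]
        gcongr
        exact ContinuousLinearMap.le_opNorm _ _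
      · exact ContinuousLinearMap.le_opNorm _ _
  obtain ⟨w, hw⟩ := hSbij.2 g
  refine ⟨(e.symm (f + β w), w), ⟨by simp [hAe], hw⟩, ?_⟩
  rintro ⟨u, w'⟩ ⟨h1, h2⟩
  have hu : u = e.symm (f + β w') := by
    rw [← heA u]
    congr 1
    simp only at h1
    rw [← h1]; abel
  have hw' : w' = w := hSbij.1 (by rw [hw, ← h2, hu])
  rw [hu, hw']

/-- The Riesz representation on a finite-dimensional inner product space. -/
theorem exists_riesz (S : Type*) [NormedAddCommGroup S] [InnerProductSpace ℝ S]
    [FiniteDimensional ℝ S] :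
    ∃ r : (S →ₗ[ℝ] ℝ) →ₗ[ℝ] S, ∀ l x, inner ℝ (r l) x = l x := by
  have : CompleteSpace S := FiniteDimensional.complete ℝ S
  refine ⟨{ toFun := fun l => (InnerProductSpace.toDual ℝ S).symm l.toContinuousLinearMap
            map_add' := fun l l' => by simp
            map_smul' := fun c l => by simp }, fun l x => ?_⟩
  exact InnerProductSpace.toDual_symm_apply

/-- The saddle point problem in terms of forms on finite-dimensional spaces. -/
theorem saddle_forms_existsUnique {V Q H : Type*} [AddCommGroup V] [Module ℝ V]
    [FiniteDimensional ℝ V] [AddCommGroup Q] [Module ℝ Q] [FiniteDimensional ℝ Q]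
    [NormedAddCommGroup H] [InnerProductSpace ℝ H]
    (E : V →ₗ[ℝ] H) (hE : Function.Injective E) (A : H → H) {γ L : ℝ} (hγ : 0 < γ)
    (hmono : ∀ x y, γ * ‖x - y‖ ^ 2 ≤ inner ℝ (A x - A y) (x - y))
    (hlip : ∀ x y, ‖A x - A y‖ ≤ L * ‖x - y‖)
    (b : V →ₗ[ℝ] Q →ₗ[ℝ] ℝ) (c : Q →ₗ[ℝ] Q →ₗ[ℝ] ℝ) (hc : ∀ w, 0 ≤ c w w)
    (hpd : ∀ w, (∀ v, b v w = 0) → c w w = 0 → w = 0) (f : V →ₗ[ℝ] ℝ) (g : Q →ₗ[ℝ] ℝ) :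
    ∃! p : V × Q, (∀ v, inner ℝ (A (E p.1)) (E v) - b v p.2 = f v) ∧
      ∀ q, b p.1 q + c p.2 q = g q := by
  -- `V` receives the inner product of `H` through `E`, so monotonicity transfers with unchanged
  -- constants. On `Q` any inner product will do, since solvability does not depend on it.
  let S : Submodule ℝ H := LinearMap.range E
  let e : V ≃ₗ[ℝ] S := LinearEquiv.ofInjective E hE
  have : FiniteDimensional ℝ S := e.finiteDimensional
  let n := Module.finrank ℝ Q
  let R := EuclideanSpace ℝ (Fin n)
  let e' : Q ≃ₗ[ℝ] R := LinearEquiv.ofFinrankEq _ _ (by simp [R, n])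
  have : CompleteSpace S := FiniteDimensional.complete ℝ S
  have he : ∀ v, ((e v : S) : H) = E v := fun v => LinearEquiv.ofInjective_apply E v
  obtain ⟨rS, hrS⟩ := exists_riesz S
  obtain ⟨rR, hrR⟩ := exists_riesz R
  -- The compression of `A` to the range of `E`: the Riesz representative is the projection of `A
  -- x`, which changes no pairing with `S` and does not increase norms.
  let A' : S → S := fun x => rS ((innerₗ H (A x)) ∘ₗ S.subtype)
  have hA' : ∀ x z : S, inner ℝ (A' x) z = inner ℝ (A x) (z : H) := fun x z => by
    simp [A', hrS]
  have hA'' : ∀ x y z : S, inner ℝ (A' x - A' y) z = inner ℝ (A x - A y) (z : H) :=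
    fun x y z => by rw [inner_sub_left, inner_sub_left, hA', hA']
  let β : R →ₗ[ℝ] S :=
    rS ∘ₗ (LinearMap.lcomp ℝ ℝ e.symm.toLinearMap) ∘ₗ b.flip ∘ₗ e'.symm.toLinearMap
  have hβ : ∀ w v, inner ℝ (β w) (e v) = b v (e'.symm w) := fun w v => by
    simp [β, hrS]
  let C : R →ₗ[ℝ] R :=
    rR ∘ₗ (LinearMap.lcomp ℝ ℝ e'.symm.toLinearMap) ∘ₗ c ∘ₗ e'.symm.toLinearMap
  have hCc : ∀ w w', inner ℝ (C w) w' = c (e'.symm w) (e'.symm w') := fun w w' => by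
    simp [C, hrR]
  have key := saddle_existsUnique A' (L := L) hγ
    (fun x y => by rw [hA'']; exact hmono x y)
    (fun x y => by
      have h : ‖A' x - A' y‖ ^ 2 ≤ ‖A x - A y‖ * ‖A' x - A' y‖ := by
        rw [← real_inner_self_eq_norm_sq, hA'']
        exact real_inner_le_norm _ _
      have h2 : ‖A' x - A' y‖ ≤ ‖A x - A y‖ := by
        by_contra hlt
        push Not at hlt
        have h0 : 0 < ‖A' x - A' y‖ := (norm_nonneg _).trans_lt hlt
        nlinarith
      exact h2.trans (hlip x y))
    β.toContinuousLinearMap C.toContinuousLinearMap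
    (fun w => by simpa [hCc] using hc _)
    (fun w h1 h2 => by
      have := hpd (e'.symm w) (fun v => by rw [← hβ]; simpa using congrArg (inner ℝ · (e v)) h1)
        (by rw [← hCc]; exact h2)
      simpa using this)
    (rS (f ∘ₗ e.symm.toLinearMap)) (rR (g ∘ₗ e'.symm.toLinearMap))
  have hiff : ∀ p : V × Q, ((∀ v, inner ℝ (A (E p.1)) (E v) - b v p.2 = f v) ∧
      ∀ q, b p.1 q + c p.2 q = g q) ↔
      (A' (e p.1) - β.toContinuousLinearMap (e' p.2) = rS (f ∘ₗ e.symm.toLinearMap) ∧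
        ContinuousLinearMap.adjoint β.toContinuousLinearMap (e p.1) +
          C.toContinuousLinearMap (e' p.2) = rR (g ∘ₗ e'.symm.toLinearMap)) := by
    intro p
    refine and_congr ⟨fun h => ext_inner_right ℝ fun z => ?_, fun h v => ?_⟩
      ⟨fun h => ext_inner_right ℝ fun z => ?_, fun h q => ?_⟩
    · obtain ⟨v, rfl⟩ := e.surjective z
      rw [inner_sub_left, hA', hrS]
      simpa [hβ, he] using h v
    · have := congrArg (inner ℝ · (e v)) h
      simp only [inner_sub_left, hA', hrS] at this
      simpa [hβ, he] using this
    · obtain ⟨q, rfl⟩ := e'.surjective z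
      rw [inner_add_left, hrR, ContinuousLinearMap.adjoint_inner_left, real_inner_comm]
      simpa [hβ, hCc] using h q
    · have := congrArg (inner ℝ · (e' q)) h
      simp only [inner_add_left, hrR, ContinuousLinearMap.adjoint_inner_left] at this
      rw [real_inner_comm] at this
      simpa [hβ, hCc] using this
  obtain ⟨⟨u, w⟩, hp, huniq⟩ := key
  refine ⟨(e.symm u, e'.symm w), (hiff _).mpr (by simpa using hp), fun p hp' => ?_⟩
  have := huniq (e p.1, e' p.2) ((hiff p).mp hp')
  rw [Prod.mk.injEq] at this
  ext <;> simp [← this.1, ← this.2]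

/-- A positive definite form on a finite-dimensional space represents every functional. -/
theorem existsUnique_of_posDef {M : Type*} [AddCommGroup M] [Module ℝ M] [FiniteDimensional ℝ M]
    (a : M →ₗ[ℝ] M →ₗ[ℝ] ℝ) (ha : ∀ q, a q q = 0 → q = 0) (l : M →ₗ[ℝ] ℝ) :
    ∃! q, ∀ ψ, a q ψ = l ψ := by
  have hinj : Function.Injective a := by
    rw [← LinearMap.ker_eq_bot, LinearMap.ker_eq_bot']
    exact fun q hq => ha q (by rw [hq]; rfl)
  have hsurj : Function.Surjective a :=
    (LinearMap.injective_iff_surjective_of_finrank_eq_finrank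
      (Subspace.dual_finrank_eq (K := ℝ) (V := M)).symm).mp hinj
  obtain ⟨q, hq⟩ := hsurj l
  exact ⟨q, fun ψ => by rw [hq], fun q' hq' => hinj (by rw [hq]; exact LinearMap.ext hq')⟩

/-- One step of the coupled scheme, in terms of forms. Here `m` is the mass form, `k` the stiffness
form, `b` the divergence form. -/
theorem step_forms_existsUnique {V M H : Type*} [AddCommGroup V] [Module ℝ V]
    [FiniteDimensional ℝ V] [AddCommGroup M] [Module ℝ M] [FiniteDimensional ℝ M]
    [NormedAddCommGroup H] [InnerProductSpace ℝ H]
    (E : V →ₗ[ℝ] H) (hE : Function.Injective E) (A : H → H) {γ L : ℝ} (hγ : 0 < γ)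
    (hmono : ∀ x y, γ * ‖x - y‖ ^ 2 ≤ inner ℝ (A x - A y) (x - y))
    (hlip : ∀ x y, ‖A x - A y‖ ≤ L * ‖x - y‖)
    (b : V →ₗ[ℝ] M →ₗ[ℝ] ℝ) (m k : M →ₗ[ℝ] M →ₗ[ℝ] ℝ) (hm0 : ∀ q, 0 ≤ m q q)
    (hm : ∀ q, m q q = 0 → q = 0) (hk : ∀ q, 0 ≤ k q q)
    (hb : ∀ ξ, (∀ v, b v ξ = 0) → ξ = 0) {κ₁ κ₂ κ₃ τ : ℝ} (h₂ : 0 < κ₂) (h₃ : 0 ≤ κ₃)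
    (hτ : 0 ≤ τ) (f : V →ₗ[ℝ] ℝ) (l : M →ₗ[ℝ] ℝ) (ηold : M) (θ : Fin 2) :
    ∃! w : V × M × M, (∀ v, inner ℝ (A (E w.1)) (E v) - b v w.2.1 = f v) ∧
      (∀ φ, κ₃ * m w.2.1 φ + b w.1 φ = κ₁ * m (if θ = 0 then ηold else w.2.2) φ) ∧
      ∀ ψ, m w.2.2 ψ + τ * k (κ₁ • w.2.1 + κ₂ • w.2.2) ψ = l ψ := by
  -- With the lagged `η` the first two equations are closed in `(u, ξ)`, and the third is then a
  -- linear positive definite problem for `η`.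
  by_cases hθ : θ = 0
  · simp only [if_pos hθ]
    obtain ⟨⟨u, ξ⟩, ⟨hu, hξ⟩, huniq⟩ := saddle_forms_existsUnique E hE A hγ hmono hlip b (κ₃ • m)
      (fun w => mul_nonneg h₃ (hm0 w)) (fun w h _ => hb w h) f (κ₁ • m ηold)
    obtain ⟨η, hη, hηu⟩ := existsUnique_of_posDef (m + (τ * κ₂) • k)
      (fun q hq => hm q (le_antisymm (by
        have h1 : 0 ≤ τ * κ₂ * k q q := mul_nonneg (mul_nonneg hτ h₂.le) (hk q)
        simp only [LinearMap.add_apply, LinearMap.smul_apply, smul_eq_mul] at hq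
        linarith) (hm0 q)))
      (l - (τ * κ₁) • k ξ)
    simp only [LinearMap.add_apply, LinearMap.smul_apply, LinearMap.sub_apply, smul_eq_mul]
      at hu hξ hη huniq hηu
    refine ⟨(u, ξ, η), ⟨hu, fun φ => by linarith [hξ φ], fun ψ => ?_⟩, ?_⟩
    · simp only [map_add, map_smul, LinearMap.add_apply, LinearMap.smul_apply, smul_eq_mul]
      linarith [hη ψ]
    · rintro ⟨u', ξ', η'⟩ ⟨h1, h2, h3⟩
      have h4 := huniq (u', ξ') ⟨h1, fun q => by linarith [h2 q]⟩
      rw [Prod.mk.injEq] at h4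
      obtain ⟨rfl, rfl⟩ := h4
      have h5 := hηu η' fun ψ => by
        have := h3 ψ
        simp only [map_add, map_smul, LinearMap.add_apply, LinearMap.smul_apply, smul_eq_mul]
          at this
        linarith
      rw [h5]
  · simp only [if_neg hθ]
    let p : M × M →ₗ[ℝ] M := κ₁ • LinearMap.fst ℝ M M + κ₂ • LinearMap.snd ℝ M M
    have hp : ∀ w, p w = κ₁ • w.1 + κ₂ • w.2 := fun w => rfl
    -- Add the constraint tested with `φ` to the diffusion equation tested with `κ₁ φ + κ₂ χ`. The
    -- terms `-κ₁ m(η, φ)` and `κ₁ m(η, φ)` cancel, leaving a positive semidefinite form.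
    let c : (M × M) →ₗ[ℝ] (M × M) →ₗ[ℝ] ℝ :=
      κ₃ • m.compl₁₂ (LinearMap.fst ℝ M M) (LinearMap.fst ℝ M M) +
      κ₂ • m.compl₁₂ (LinearMap.snd ℝ M M) (LinearMap.snd ℝ M M) + τ • k.compl₁₂ p p
    have hc : ∀ w w', c w w' = κ₃ * m w.1 w'.1 + κ₂ * m w.2 w'.2 + τ * k (p w) (p w') :=
      fun w w' => rfl
    let b' : V →ₗ[ℝ] (M × M) →ₗ[ℝ] ℝ := b.compl₂ (LinearMap.fst ℝ M M)
    have hb' : ∀ v w, b' v w = b v w.1 := fun v w => rfl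
    have key := saddle_forms_existsUnique E hE A hγ hmono hlip b' c
      (fun w => by
        have := mul_nonneg h₃ (hm0 w.1)
        have := mul_nonneg h₂.le (hm0 w.2)
        have := mul_nonneg hτ (hk (p w))
        rw [hc]; linarith)
      -- As `κ₃` may vanish, `ξ` is controlled only through `b`; the `κ₂` term controls `η`.
      (fun w h h' => by
        have h1 := mul_nonneg h₃ (hm0 w.1)
        have h2 := mul_nonneg h₂.le (hm0 w.2)
        have h3 := mul_nonneg hτ (hk (p w))
        rw [hc] at h'
        have h4 : κ₂ * m w.2 w.2 = 0 := by linarith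
        exact Prod.ext (hb _ h) (hm _ ((mul_eq_zero.mp h4).resolve_left h₂.ne')))
      f (l ∘ₗ p)
    refine (existsUnique_congr fun w => and_congr_right fun _ => ?_).mp key
    obtain ⟨u, ξ, η⟩ := w
    simp only [hc, hb', LinearMap.comp_apply]
    constructor
    · intro h
      have h3 : ∀ ψ, m η ψ + τ * k (κ₁ • ξ + κ₂ • η) ψ = l ψ := by
        intro ψ
        -- This pair is mapped to `ψ` by `p` and has no `φ` component, so it isolates the diffusion
        -- equation.
        have h4 := h (0, κ₂⁻¹ • ψ)
        have h5 : p (0, κ₂⁻¹ • ψ) = ψ := by simp [hp, smul_smul, h₂.ne']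
        rw [h5, hp] at h4
        simp only [map_zero, mul_zero, map_smul, smul_eq_mul, zero_add] at h4
        rw [mul_inv_cancel_left₀ h₂.ne'] at h4
        exact h4
      refine ⟨fun φ => ?_, h3⟩
      have h4 := h (φ, 0)
      have h5 := h3 (κ₁ • φ)
      rw [hp, hp] at h4
      simp only [map_zero, mul_zero, smul_zero, add_zero] at h4
      simp only [map_smul, smul_eq_mul] at h4 h5
      linarith
    · rintro ⟨h1, h2⟩ ⟨φ, χ⟩
      have h4 := h1 φ
      have h5 := h2 (κ₁ • φ + κ₂ • χ)
      simp only [hp]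
      simp only [map_add, map_smul, smul_eq_mul, LinearMap.add_apply,
        LinearMap.smul_apply] at h5 ⊢
      linarith

/-! ### Radial laws in an inner product space. -/

section Radial

variable {X : Type*} [NormedAddCommGroup X] [InnerProductSpace ℝ X]

/-- Strong monotonicity of `a ↦ h(‖a‖²) a`. -/
theorem radial_strongly_monotone {h : ℝ → ℝ} {c : ℝ} (hc : ∀ r, 0 ≤ r → c ≤ h r)
    (hg : ∀ s t, 0 ≤ t → t ≤ s → c * (s - t) ≤ s * h (s ^ 2) - t * h (t ^ 2)) (a b : X) :
    c * ‖a - b‖ ^ 2 ≤ inner ℝ (h (‖a‖ ^ 2) • a - h (‖b‖ ^ 2) • b) (a - b) := by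
  have e1 : ‖a - b‖ ^ 2 = ‖a‖ ^ 2 - 2 * inner ℝ a b + ‖b‖ ^ 2 := norm_sub_sq_real a b
  have e2 : inner ℝ (h (‖a‖ ^ 2) • a - h (‖b‖ ^ 2) • b) (a - b) =
      h (‖a‖ ^ 2) * ‖a‖ ^ 2 + h (‖b‖ ^ 2) * ‖b‖ ^ 2
        - (h (‖a‖ ^ 2) + h (‖b‖ ^ 2)) * inner ℝ a b := by
    simp only [inner_sub_left, inner_sub_right, real_inner_smul_left, real_inner_self_eq_norm_sq,
      real_inner_comm a b]
    ring
  rw [e1, e2]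
  have hX := real_inner_le_norm a b
  generalize inner ℝ a b = X at *
  have ha := norm_nonneg a
  have hb := norm_nonneg b
  generalize ‖a‖ = s at *
  generalize ‖b‖ = t at *
  have h1 := hc _ (sq_nonneg s)
  have h2 := hc _ (sq_nonneg t)
  have h3 : c * (s - t) ^ 2 ≤ (s * h (s ^ 2) - t * h (t ^ 2)) * (s - t) := by
    rcases le_total t s with hts | hts
    · nlinarith [mul_le_mul_of_nonneg_right (hg s t hb hts) (sub_nonneg.mpr hts)]
    · nlinarith [mul_le_mul_of_nonneg_right (hg t s ha hts) (sub_nonneg.mpr hts)]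
  -- With `X = ⟪a, b⟫`, the pairing is `(s h(s²) - t h(t²))(s - t) + (h(s²) + h(t²))(st - X)`, while
  -- `‖a - b‖² = (s - t)² + 2(st - X)`; the summands are compared separately.
  have h4 := mul_nonneg (add_nonneg (sub_nonneg.mpr h1) (sub_nonneg.mpr h2)) (sub_nonneg.mpr hX)
  nlinarith

/-- Lipschitz continuity of `a ↦ h(‖a‖²) a`. -/
theorem radial_lipschitz {h : ℝ → ℝ} {L : ℝ} (h0 : ∀ r, 0 ≤ r → 0 ≤ h r)
    (hL : ∀ r, 0 ≤ r → h r ≤ L)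
    (hg : ∀ s t, 0 ≤ t → t ≤ s → |s * h (s ^ 2) - t * h (t ^ 2)| ≤ L * (s - t)) (a b : X) :
    ‖h (‖a‖ ^ 2) • a - h (‖b‖ ^ 2) • b‖ ^ 2 ≤ L ^ 2 * ‖a - b‖ ^ 2 := by
  rw [norm_sub_sq_real, norm_sub_sq_real, norm_smul, norm_smul, real_inner_smul_left,
    real_inner_smul_right, mul_pow, mul_pow, Real.norm_eq_abs, Real.norm_eq_abs, sq_abs, sq_abs]
  have hX := real_inner_le_norm a b
  generalize inner ℝ a b = X at *
  have ha := norm_nonneg a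
  have hb := norm_nonneg b
  generalize ‖a‖ = s at *
  generalize ‖b‖ = t at *
  have h1 := h0 _ (sq_nonneg s)
  have h2 := h0 _ (sq_nonneg t)
  have h1' := hL _ (sq_nonneg s)
  have h2' := hL _ (sq_nonneg t)
  have h3 : (s * h (s ^ 2) - t * h (t ^ 2)) ^ 2 ≤ L ^ 2 * (s - t) ^ 2 := by
    have h4 : |s * h (s ^ 2) - t * h (t ^ 2)| ≤ L * |s - t| := by
      rcases le_total t s with hts | hts
      · rw [abs_of_nonneg (sub_nonneg.mpr hts)]
        exact hg s t hb hts
      · rw [abs_sub_comm, abs_sub_comm s, abs_of_nonneg (sub_nonneg.mpr hts)]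
        exact hg t s ha hts
    calc _ = |s * h (s ^ 2) - t * h (t ^ 2)| ^ 2 := (sq_abs _).symm
      _ ≤ (L * |s - t|) ^ 2 := pow_le_pow_left₀ (abs_nonneg _) h4 2
      _ = _ := by rw [mul_pow, sq_abs]
  -- The left side of the goal is `(s h(s²) - t h(t²))² + 2 h(s²) h(t²) (st - X)`, to be compared
  -- with `L²` times `(s - t)² + 2(st - X)`.
  have h4 : h (s ^ 2) * h (t ^ 2) ≤ L ^ 2 := by
    rw [sq L]; exact mul_le_mul h1' h2' h2 (h1.trans h1')
  have h5 := mul_le_mul_of_nonneg_right h4 (sub_nonneg.mpr hX)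
  nlinarith

/-- The part of `a` orthogonal to `e`, where `n = ⟪e, e⟫`. -/
noncomputable def offPart (e : X) (n : ℝ) (a : X) : X := a - (inner ℝ e a / n) • e

/-- The Hencky–Mises type law `k ⟪e, a⟫ e + h(‖D a‖²) D a`, with `D` the part orthogonal to `e`. -/
noncomputable def radialLaw (e : X) (n : ℝ) (h : ℝ → ℝ) (k : ℝ) (a : X) : X :=
  (k * inner ℝ e a) • e + h (‖offPart e n a‖ ^ 2) • offPart e n a

theorem offPart_sub (e : X) (n : ℝ) (a b : X) :
    offPart e n (a - b) = offPart e n a - offPart e n b := by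
  simp only [offPart, inner_sub_right]; module

theorem inner_offPart {e : X} {n : ℝ} (hn : 0 < n) (he : inner ℝ e e = n) (a : X) :
    inner ℝ e (offPart e n a) = 0 := by
  simp only [offPart, inner_sub_right, real_inner_smul_right, he]
  field_simp
  ring

theorem norm_sq_offPart {e : X} {n : ℝ} (hn : 0 < n) (he : inner ℝ e e = n) (a : X) :
    ‖offPart e n a‖ ^ 2 = ‖a‖ ^ 2 - inner ℝ e a ^ 2 / n := by
  rw [offPart, norm_sub_sq_real, norm_smul, mul_pow, ← real_inner_self_eq_norm_sq e, he,
    real_inner_smul_right, real_inner_comm, Real.norm_eq_abs, sq_abs]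
  field_simp
  ring

/-- The component along `e` and the orthogonal one do not interact, so every estimate splits in two.
-/
theorem radialLaw_sub_inner {e : X} {n : ℝ} (hn : 0 < n) (he : inner ℝ e e = n) (h : ℝ → ℝ)
    (k : ℝ) (a b c : X) :
    inner ℝ (radialLaw e n h k a - radialLaw e n h k b) c =
      k * inner ℝ e (a - b) * inner ℝ e c +
      inner ℝ (h (‖offPart e n a‖ ^ 2) • offPart e n a -
        h (‖offPart e n b‖ ^ 2) • offPart e n b) (offPart e n c) := by
  have hc : c = offPart e n c + (inner ℝ e c / n) • e := by simp [offPart]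
  have h0 : ∀ a, inner ℝ (offPart e n a) e = 0 := fun a => by
    rw [real_inner_comm]; exact inner_offPart hn he a
  conv_lhs => rw [hc]
  simp only [radialLaw, inner_add_left, inner_sub_left, inner_add_right, real_inner_smul_left,
    real_inner_smul_right, he, h0, inner_offPart hn he, inner_sub_right]
  field_simp
  ring

/-- By Pythagoras `‖a - b‖²` is the squared orthogonal part plus `⟪e, a - b⟫² / n`. The law gains a
factor `c` on the former and `k n` on the latter, whence the minimum. -/
theorem radialLaw_strongly_monotone {e : X} {n : ℝ} (hn : 0 < n) (he : inner ℝ e e = n)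
    {h : ℝ → ℝ} {c : ℝ} (hc : ∀ r, 0 ≤ r → c ≤ h r)
    (hg : ∀ s t, 0 ≤ t → t ≤ s → c * (s - t) ≤ s * h (s ^ 2) - t * h (t ^ 2))
    {k k₀ : ℝ} (hk : k₀ ≤ k) (a b : X) :
    min (k₀ * n) c * ‖a - b‖ ^ 2 ≤
      inner ℝ (radialLaw e n h k a - radialLaw e n h k b) (a - b) := by
  rw [radialLaw_sub_inner hn he]
  have h1 := radial_strongly_monotone hc hg (offPart e n a) (offPart e n b)
  rw [← offPart_sub] at h1
  have h2 := norm_sq_offPart hn he (a - b)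
  have h3 : ‖a - b‖ ^ 2 = ‖offPart e n (a - b)‖ ^ 2 + inner ℝ e (a - b) ^ 2 / n := by linarith
  rw [h3, mul_add]
  have h4 : min (k₀ * n) c * ‖offPart e n (a - b)‖ ^ 2 ≤ c * ‖offPart e n (a - b)‖ ^ 2 :=
    mul_le_mul_of_nonneg_right (min_le_right _ _) (sq_nonneg _)
  have h5 : min (k₀ * n) c * (inner ℝ e (a - b) ^ 2 / n) ≤ k * n * (inner ℝ e (a - b) ^ 2 / n) :=
    mul_le_mul_of_nonneg_right ((min_le_left _ _).trans (by gcongr)) (by positivity)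
  have h6 : k * n * (inner ℝ e (a - b) ^ 2 / n) = k * inner ℝ e (a - b) * inner ℝ e (a - b) := by
    field_simp
  linarith

/-- As `‖e‖² = n`, the component along `e` contributes `k ‖e‖² ≤ k₁ n`; the orthogonal part
contributes `L`. -/
theorem radialLaw_lipschitz {e : X} {n : ℝ} (hn : 0 < n) (he : inner ℝ e e = n)
    {h : ℝ → ℝ} {L : ℝ} (h0 : ∀ r, 0 ≤ r → 0 ≤ h r) (hL : ∀ r, 0 ≤ r → h r ≤ L)
    (hg : ∀ s t, 0 ≤ t → t ≤ s → |s * h (s ^ 2) - t * h (t ^ 2)| ≤ L * (s - t))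
    {k k₁ : ℝ} (hk0 : 0 ≤ k) (hk : k ≤ k₁) (a b : X) :
    ‖radialLaw e n h k a - radialLaw e n h k b‖ ≤ (k₁ * n + L) * ‖a - b‖ := by
  have h1 := radial_lipschitz h0 hL hg (offPart e n a) (offPart e n b)
  rw [← offPart_sub] at h1
  have h2 := norm_sq_offPart hn he (a - b)
  have hL0 : 0 ≤ L := (h0 0 le_rfl).trans (hL 0 le_rfl)
  have e1 : radialLaw e n h k a - radialLaw e n h k b =
      (k * inner ℝ e (a - b)) • e + (h (‖offPart e n a‖ ^ 2) • offPart e n a -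
        h (‖offPart e n b‖ ^ 2) • offPart e n b) := by
    simp only [radialLaw, inner_sub_right]; module
  have hk1 : 0 ≤ k₁ := hk0.trans hk
  rw [e1, add_mul]
  refine (norm_add_le _ _).trans (add_le_add ?_ ?_)
  · refine le_of_sq_le_sq ?_ (by positivity)
    rw [norm_smul, mul_pow, mul_pow, ← real_inner_self_eq_norm_sq e, he, Real.norm_eq_abs, sq_abs]
    have h3 : inner ℝ e (a - b) ^ 2 ≤ n * ‖a - b‖ ^ 2 := by
      have h4 : inner ℝ e (a - b) ^ 2 / n ≤ ‖a - b‖ ^ 2 := by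
        linarith [sq_nonneg ‖offPart e n (a - b)‖]
      rwa [div_le_iff₀' hn] at h4
    have h5 : k ^ 2 ≤ k₁ ^ 2 := by gcongr
    calc (k * inner ℝ e (a - b)) ^ 2 * n = k ^ 2 * inner ℝ e (a - b) ^ 2 * n := by ring
      _ ≤ k₁ ^ 2 * (n * ‖a - b‖ ^ 2) * n := by gcongr
      _ = _ := by ring
  · refine le_of_sq_le_sq ?_ (by positivity)
    rw [mul_pow]
    refine h1.trans ?_
    have : 0 ≤ inner ℝ e (a - b) ^ 2 / n := by positivity
    gcongr 1
    linarith

theorem radialLaw_zero (e : X) (n : ℝ) (h : ℝ → ℝ) (k : ℝ) : radialLaw e n h k 0 = 0 := by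
  simp [radialLaw, offPart]

/-- Joint continuity in coefficient and argument yields measurability of the superposition.
Continuity of `h` on `[0, ∞)` suffices because `h` is evaluated at squares. -/
theorem continuous_radialLaw {e : X} {n : ℝ} {h : ℝ → ℝ} (hh : ContinuousOn h (Ici 0)) :
    Continuous fun p : ℝ × X => radialLaw e n h p.1 p.2 := by
  have h1 : Continuous fun p : ℝ × X => offPart e n p.2 := by unfold offPart; fun_prop
  have h2 : Continuous fun p : ℝ × X => h (‖offPart e n p.2‖ ^ 2) :=
    hh.comp_continuous (by fun_prop) fun p => mem_Ici.mpr (sq_nonneg _)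
  have h3 : Continuous fun p : ℝ × X => p.1 * inner ℝ e p.2 := by fun_prop
  exact (h3.smul continuous_const).add (h2.smul h1)

end Radial

/-! ### Superposition operators on `L²`. -/

/-- The superposition operator on `L²` of a monotone Lipschitz law. -/
theorem exists_superposition {α X : Type*} [MeasurableSpace α] {ν : Measure α}
    [NormedAddCommGroup X] [InnerProductSpace ℝ X] (a : α → X → X) {γ L : ℝ}
    (hmeas : ∀ F : α → X, AEStronglyMeasurable F ν →
      AEStronglyMeasurable (fun x => a x (F x)) ν)
    (hzero : ∀ᵐ x ∂ν, a x 0 = 0)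
    (hmono : ∀ᵐ x ∂ν, ∀ y z, γ * ‖y - z‖ ^ 2 ≤ inner ℝ (a x y - a x z) (y - z))
    (hlip : ∀ᵐ x ∂ν, ∀ y z, ‖a x y - a x z‖ ≤ L * ‖y - z‖) :
    ∃ A : Lp X 2 ν → Lp X 2 ν, (∀ F, A F =ᵐ[ν] fun x => a x (F x)) ∧
      (∀ F G, γ * ‖F - G‖ ^ 2 ≤ inner ℝ (A F - A G) (F - G)) ∧
      ∀ F G, ‖A F - A G‖ ≤ L * ‖F - G‖ := by
  -- Being Lipschitz and zero at zero, the law grows at most linearly, so it preserves `L²`.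
  have hmem : ∀ F : Lp X 2 ν, MemLp (fun x => a x (F x)) 2 ν := fun F => by
    refine (Lp.memLp F).of_le_mul (c := L) (hmeas _ (Lp.aestronglyMeasurable F)) ?_
    filter_upwards [hzero, hlip] with x h0 h1
    have := h1 (F x) 0
    rwa [h0, sub_zero, sub_zero] at this
  let A : Lp X 2 ν → Lp X 2 ν := fun F => (hmem F).toLp _
  have hA : ∀ F, A F =ᵐ[ν] fun x => a x (F x) := fun F => (hmem F).coeFn_toLp
  refine ⟨A, hA, fun F G => ?_, fun F G => ?_⟩
  · rw [← real_inner_self_eq_norm_sq, L2.inner_def, L2.inner_def, ← integral_const_mul]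
    refine integral_mono_ae ((L2.integrable_inner _ _).const_mul _) (L2.integrable_inner _ _) ?_
    filter_upwards [hmono, hA F, hA G, Lp.coeFn_sub F G, Lp.coeFn_sub (A F) (A G)]
      with x h1 h2 h3 h4 h5
    simp only [h4, h5, Pi.sub_apply, h2, h3, real_inner_self_eq_norm_sq]
    exact h1 _ _
  · refine Lp.norm_le_mul_norm_of_ae_le_mul ?_
    filter_upwards [hlip, hA F, hA G, Lp.coeFn_sub F G, Lp.coeFn_sub (A F) (A G)]
      with x h1 h2 h3 h4 h5
    simp only [h4, h5, Pi.sub_apply, h2, h3]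
    exact h1 _ _

/-- The superposition operator on `L²` of the law `radialLaw`. -/
theorem exists_radialLaw_operator {α X : Type*} [MeasurableSpace α] {ν : Measure α}
    [NormedAddCommGroup X] [InnerProductSpace ℝ X] {e : X} {n : ℝ} (hn : 0 < n)
    (he : inner ℝ e e = n) {h : ℝ → ℝ} (hcont : ContinuousOn h (Ici 0)) {c L : ℝ} (hc0 : 0 < c)
    (hc : ∀ r, 0 ≤ r → c ≤ h r) (hL : ∀ r, 0 ≤ r → h r ≤ L)
    (hg : ∀ s t, 0 ≤ t → t ≤ s → c * (s - t) ≤ s * h (s ^ 2) - t * h (t ^ 2))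
    (hg' : ∀ s t, 0 ≤ t → t ≤ s → |s * h (s ^ 2) - t * h (t ^ 2)| ≤ L * (s - t))
    {k : α → ℝ} (hk : AEStronglyMeasurable k ν) {k₀ k₁ : ℝ} (hk0 : 0 < k₀)
    (hkb : ∀ᵐ x ∂ν, k₀ ≤ k x ∧ k x ≤ k₁) :
    ∃ (A : Lp X 2 ν → Lp X 2 ν) (γ L' : ℝ), 0 < γ ∧
      (∀ F, A F =ᵐ[ν] fun x => radialLaw e n h (k x) (F x)) ∧
      (∀ F G, γ * ‖F - G‖ ^ 2 ≤ inner ℝ (A F - A G) (F - G)) ∧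
      ∀ F G, ‖A F - A G‖ ≤ L' * ‖F - G‖ := by
  obtain ⟨A, hA, hA1, hA2⟩ := exists_superposition (ν := ν)
    (fun x => radialLaw e n h (k x)) (γ := min (k₀ * n) c) (L := k₁ * n + L)
    (fun F hF => (continuous_radialLaw hcont).comp_aestronglyMeasurable (hk.prodMk hF))
    (Filter.Eventually.of_forall fun x => radialLaw_zero _ _ _ _)
    (hkb.mono fun x hx y z => radialLaw_strongly_monotone hn he hc hg hx.1 y z)
    (hkb.mono fun x hx y z => radialLaw_lipschitz hn he (fun r hr => hc0.le.trans (hc r hr)) hL hg'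
      (hk0.le.trans hx.1) hx.2 y z)
  exact ⟨A, _, _, lt_min (mul_pos hk0 hn) hc0, hA, hA1, hA2⟩

/-! ### The Hencky–Mises stress as a radial law. -/

namespace Poro

variable {d : ℕ}

namespace Material

theorem hasDerivWithinAt_dPhi {m : Material d} (h : ContDiffOn ℝ 2 m.Phi (Ici 0)) {r : ℝ}
    (hr : 0 ≤ r) : HasDerivWithinAt m.dPhi (m.ddPhi r) (Ici 0) r := by
  have h1 : ContDiffOn ℝ 1 m.dPhi (Ici 0) := h.derivWithin (uniqueDiffOn_Ici 0) (by norm_num)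
  exact ((h1.differentiableOn one_ne_zero) r hr).hasDerivWithinAt

theorem continuousOn_dPhi {m : Material d} (h : ContDiffOn ℝ 2 m.Phi (Ici 0)) :
    ContinuousOn m.dPhi (Ici 0) := fun _ hr => (hasDerivWithinAt_dPhi h hr).continuousWithinAt

/-- With `ρ = s²` the derivative is the combination `Φ'(ρ) + 2ρΦ''(ρ)` of the hypotheses. For `s >
0` the point `s²` is interior to `[0, ∞)`, so the one-sided derivative is two-sided. -/
theorem hasDerivAt_mul_dPhi_sq {m : Material d} (h : ContDiffOn ℝ 2 m.Phi (Ici 0)) {s : ℝ}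
    (hs : 0 < s) : HasDerivAt (fun s => s * m.dPhi (s ^ 2))
      (m.dPhi (s ^ 2) + 2 * s ^ 2 * m.ddPhi (s ^ 2)) s := by
  have h1 : HasDerivAt m.dPhi (m.ddPhi (s ^ 2)) (s ^ 2) :=
    (hasDerivWithinAt_dPhi h (sq_nonneg s)).hasDerivAt (Ici_mem_nhds (by positivity))
  have h2 : HasDerivAt (fun s : ℝ => s ^ 2) (2 * s) s := by simpa using hasDerivAt_pow 2 s
  have h3 : HasDerivAt (fun s => m.dPhi (s ^ 2)) (m.ddPhi (s ^ 2) * (2 * s)) s :=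
    HasDerivAt.comp (h₂ := m.dPhi) (h := fun s : ℝ => s ^ 2) s h1 h2
  refine ((hasDerivAt_id s).mul h3).congr_deriv ?_
  simp only [id_eq]
  ring

/-- The function `μ̃ = 2 μ Φ'` is bounded, bounded away from zero, and `s ↦ s μ̃(s²)` is strongly
increasing and Lipschitz. -/
theorem IsAdmissible.muT_bounds {m : Material d} {Ω : Set (E d)} (hm : m.IsAdmissible Ω)
    (hΩ : Ω.Nonempty) : ∃ c L : ℝ, 0 < c ∧ (∀ r, 0 ≤ r → c ≤ m.muT r) ∧
      (∀ r, 0 ≤ r → m.muT r ≤ L) ∧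
      (∀ s t, 0 ≤ t → t ≤ s → c * (s - t) ≤ s * m.muT (s ^ 2) - t * m.muT (t ^ 2)) ∧
      (∀ s t, 0 ≤ t → t ≤ s → |s * m.muT (s ^ 2) - t * m.muT (t ^ 2)| ≤ L * (s - t)) := by
  obtain ⟨C₁, C₂, C₃, h1, h2, h3, hb⟩ := hm.Phi_bounds
  obtain ⟨k₀, k₁, hk0, -, hk⟩ := hm.kappa_bounds
  obtain ⟨x, hx⟩ := hΩ
  have hμ := hm.mu_pos
  have hup : ∀ r, 0 ≤ r → m.mu * m.dPhi r ≤ k₁ := fun r hr =>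
    ((hb r hr).2.1 x hx).le.trans (hk x hx).2
  have hk1 : 0 < k₁ := hk0.trans_le ((hk x hx).1.trans (hk x hx).2)
  have hcont : ContinuousOn (fun s => s * m.dPhi (s ^ 2)) (Ici 0) :=
    continuousOn_id.mul ((continuousOn_dPhi hm.Phi_smooth).comp (by fun_prop)
      fun s _ => mem_Ici.mpr (sq_nonneg s))
  have hdiff : DifferentiableOn ℝ (fun s => s * m.dPhi (s ^ 2)) (interior (Ici 0)) := by
    rw [interior_Ici]
    exact fun s hs => (hasDerivAt_mul_dPhi_sq hm.Phi_smooth hs).differentiableAt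
      |>.differentiableWithinAt
  have hlow : ∀ s t, 0 ≤ t → t ≤ s →
      C₃ * (s - t) ≤ s * m.dPhi (s ^ 2) - t * m.dPhi (t ^ 2) := fun s t ht hts => by
    refine (convex_Ici 0).mul_sub_le_image_sub_of_le_deriv hcont hdiff (fun y hy => ?_) t ht s
      (ht.trans hts) hts
    rw [interior_Ici] at hy
    rw [(hasDerivAt_mul_dPhi_sq hm.Phi_smooth hy).deriv]
    exact (hb _ (sq_nonneg y)).2.2.2
  have hhigh : ∀ s t, 0 ≤ t → t ≤ s →
      s * m.dPhi (s ^ 2) - t * m.dPhi (t ^ 2) ≤ (k₁ / m.mu + 2 * C₂) * (s - t) :=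
      fun s t ht hts => by
    refine (convex_Ici 0).image_sub_le_mul_sub_of_deriv_le hcont hdiff (fun y hy => ?_) t ht s
      (ht.trans hts) hts
    rw [interior_Ici] at hy
    rw [(hasDerivAt_mul_dPhi_sq hm.Phi_smooth hy).deriv]
    have e1 := (hb _ (sq_nonneg y)).2.2.1
    have e2 : m.dPhi (y ^ 2) ≤ k₁ / m.mu := by
      rw [le_div_iff₀' hμ]; exact hup _ (sq_nonneg y)
    linarith [(abs_le.mp e1).2]
  have hμL : 2 * m.mu * (k₁ / m.mu + 2 * C₂) = 2 * k₁ + 4 * m.mu * C₂ := by field_simp; ring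
  refine ⟨min (2 * C₁) (2 * m.mu * C₃), 2 * k₁ + 4 * m.mu * C₂, by positivity, fun r hr => ?_,
    fun r hr => ?_, fun s t ht hts => ?_, fun s t ht hts => ?_⟩
  · refine (min_le_left _ _).trans ?_
    rw [muT]; linarith [(hb r hr).1]
  · have : 0 ≤ 4 * m.mu * C₂ := by positivity
    rw [muT]; linarith [hup r hr]
  · calc _ ≤ 2 * m.mu * C₃ * (s - t) :=
        mul_le_mul_of_nonneg_right (min_le_right _ _) (sub_nonneg.mpr hts)
      _ ≤ 2 * m.mu * (s * m.dPhi (s ^ 2) - t * m.dPhi (t ^ 2)) := by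
        rw [mul_assoc]; exact mul_le_mul_of_nonneg_left (hlow s t ht hts) (by positivity)
      _ = _ := by simp only [muT]; ring
  · have e : s * m.muT (s ^ 2) - t * m.muT (t ^ 2) =
        2 * m.mu * (s * m.dPhi (s ^ 2) - t * m.dPhi (t ^ 2)) := by simp only [muT]; ring
    have h0 : 0 ≤ s * m.dPhi (s ^ 2) - t * m.dPhi (t ^ 2) :=
      (mul_nonneg h3.le (sub_nonneg.mpr hts)).trans (hlow s t ht hts)
    rw [e, abs_of_nonneg (by positivity), ← hμL, mul_assoc (2 * m.mu)]
    exact mul_le_mul_of_nonneg_left (hhigh s t ht hts) (by positivity)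

end Material

/-- Matrices with the Frobenius inner product. -/
abbrev FrobSpace (d : ℕ) := EuclideanSpace ℝ (Fin d × Fin d)

/-- A matrix as an element of the Euclidean space of matrices. -/
def toFrob (A : Matrix (Fin d) (Fin d) ℝ) : FrobSpace d := WithLp.toLp 2 fun p => A p.1 p.2

theorem inner_toFrob (A B : Matrix (Fin d) (Fin d) ℝ) :
    inner ℝ (toFrob A) (toFrob B) = frob A B := by
  simp only [toFrob, frob, PiLp.inner_apply, Fintype.sum_prod_type]
  simp [mul_comm]

theorem inner_toFrob_one (A : Matrix (Fin d) (Fin d) ℝ) :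
    inner ℝ (toFrob 1) (toFrob A) = A.trace := by
  rw [inner_toFrob]
  simp [frob, Matrix.trace, Matrix.one_apply]

theorem toFrob_add (A B : Matrix (Fin d) (Fin d) ℝ) : toFrob (A + B) = toFrob A + toFrob B := rfl

theorem toFrob_smul (c : ℝ) (A : Matrix (Fin d) (Fin d) ℝ) : toFrob (c • A) = c • toFrob A := rfl

theorem strain_isSymm (u : E d → E d) (x : E d) : (strain u x).IsSymm := by
  simp [Matrix.IsSymm, strain, add_comm]

theorem trace_strain (u : E d → E d) (x : E d) : (strain u x).trace = divg u x := by
  simp only [strain, divg, Matrix.trace_smul, Matrix.trace_add, Matrix.trace_transpose,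
    smul_eq_mul]
  ring

/-- The part of `A` orthogonal to the identity is its trace-free part; symmetry turns `tr(A²)` into
the squared Frobenius norm. -/
theorem norm_sq_offPart_toFrob (hd : 0 < d) {A : Matrix (Fin d) (Fin d) ℝ} (hA : A.IsSymm) :
    ‖offPart (toFrob 1) (d : ℝ) (toFrob A)‖ ^ 2 = dev A := by
  rw [norm_sq_offPart (by positivity) (by rw [inner_toFrob_one]; simp), inner_toFrob_one,
    ← real_inner_self_eq_norm_sq, inner_toFrob, dev, frob, Matrix.trace]
  congr 1
  · exact Finset.sum_congr rfl fun i _ => by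
      rw [Matrix.diag_apply, Matrix.mul_apply]
      exact Finset.sum_congr rfl fun j _ => by rw [hA.apply i j]
  · ring

/-- The stress operator of the scheme is a Hencky–Mises type law on the space of matrices. -/
theorem toFrob_Nop (hd : 0 < d) (m : Material d) (u : E d → E d) (x : E d) :
    toFrob (m.Nop u x) = radialLaw (toFrob 1) d m.muT (m.kappa x - 1 / m.lam)
      (toFrob (strain u x)) := by
  rw [radialLaw, norm_sq_offPart_toFrob hd (strain_isSymm u x), inner_toFrob_one, trace_strain]
  -- The term `-μ̃/d div u` of `λ̃ div u` is moved into the second summand, which becomes `μ̃` times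
  -- the deviator.
  have : m.Nop u x = ((m.kappa x - 1 / m.lam) * divg u x) • (1 : Matrix (Fin d) (Fin d) ℝ) +
      m.muT (dev (strain u x)) • (strain u x - (divg u x / d) • 1) := by
    simp only [Material.Nop, Material.stress, Material.lamT, trace_strain]
    module
  rw [this, toFrob_add, toFrob_smul, toFrob_smul, offPart, inner_toFrob_one, trace_strain]
  rfl

/-- The stress operator on `L²`. -/
theorem exists_stress_operator (hd : 0 < d) {m : Material d} {Ω : Set (E d)} (hΩo : IsOpen Ω)
    (hΩ : Ω.Nonempty) (hm : m.IsAdmissible Ω) :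
    ∃ (A : Lp (FrobSpace d) 2 (volume.restrict Ω) → Lp (FrobSpace d) 2 (volume.restrict Ω))
      (γ L : ℝ), 0 < γ ∧
      (∀ F, A F =ᵐ[volume.restrict Ω] fun x =>
        radialLaw (toFrob 1) d m.muT (m.kappa x - 1 / m.lam) (F x)) ∧
      (∀ F G, γ * ‖F - G‖ ^ 2 ≤ inner ℝ (A F - A G) (F - G)) ∧
      ∀ F G, ‖A F - A G‖ ≤ L * ‖F - G‖ := by
  obtain ⟨c, L, hc, h1, h2, h3, h4⟩ := hm.muT_bounds hΩ
  obtain ⟨k₀, k₁, hk0, hlam, hk⟩ := hm.kappa_bounds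
  have hd' : (0 : ℝ) < d := by exact_mod_cast hd
  have he : inner ℝ (toFrob (1 : Matrix (Fin d) (Fin d) ℝ)) (toFrob 1) = (d : ℝ) := by
    rw [inner_toFrob_one]; simp
  have hcont : ContinuousOn m.muT (Ici 0) :=
    continuousOn_const.mul (Material.continuousOn_dPhi hm.Phi_smooth)
  exact exists_radialLaw_operator hd' he hcont hc h1 h2 h3 h4
    ((hm.kappa_cont.aestronglyMeasurable hΩo.measurableSet).sub aestronglyMeasurable_const)
    (k₀ := k₀ - 1 / m.lam) (k₁ := k₁ - 1 / m.lam) (by linarith)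
    ((ae_restrict_mem hΩo.measurableSet).mono fun x hx =>
      ⟨sub_le_sub_right (hk x hx).1 _, sub_le_sub_right (hk x hx).2 _⟩)

end Poro

/-! ### Finiteness of the surface measure. -/

namespace Poro

/-- A bounded part of a hyperplane of `ℝ^(n+1)` has finite `n`-dimensional Hausdorff measure. -/
theorem hausdorff_lt_top_of_subset_hyperplane {n : ℕ} (l : StrongDual ℝ (E (n + 1))) (hl : l ≠ 0)
    (c : ℝ) {B : Set (E (n + 1))} (hB : Bornology.IsBounded B) (hBl : ∀ x ∈ B, l x = c) :
    Measure.euclideanHausdorffMeasure n B < ⊤ := by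
  rcases B.eq_empty_or_nonempty with rfl | ⟨x₀, hx₀⟩
  · simp
  let N := LinearMap.ker l.toLinearMap
  have hN : Module.finrank ℝ N = n := by
    have h0 : l.toLinearMap ≠ 0 := fun h => hl (ContinuousLinearMap.coe_injective h)
    have := Module.Dual.finrank_ker_add_one_of_ne_zero (f := l.toLinearMap) h0
    rw [finrank_euclideanSpace_fin] at this
    exact Nat.succ_injective this
  let b : OrthonormalBasis (Fin n) ℝ N := (stdOrthonormalBasis ℝ N).reindex (finCongr hN)
  let f : EuclideanSpace ℝ (Fin n) → E (n + 1) := fun y => x₀ + ((b.repr.symm y : N) : E (n + 1))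
  have hf : Isometry f := by
    refine Isometry.of_dist_eq fun y z => ?_
    simp only [f, dist_add_left]
    exact b.repr.symm.isometry.dist_eq y z
  have himg : B ⊆ f '' (f ⁻¹' B) := by
    intro x hx
    have hxN : x - x₀ ∈ N := by
      simp [N, LinearMap.mem_ker, hBl x hx, hBl x₀ hx₀]
    have hfx : f (b.repr ⟨x - x₀, hxN⟩) = x := by simp [f]
    exact ⟨_, by rw [mem_preimage, hfx]; exact hx, hfx⟩
  refine (measure_mono himg).trans_lt ?_
  rw [hf.euclideanHausdorffMeasure_image, EuclideanSpace.euclideanHausdorffMeasure_eq_volume]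
  exact (hf.antilipschitz.isBounded_preimage hB).measure_lt_top

/-- A point of a polytope where a linear functional is maximal is in the convex hull of the
vertices where it is maximal. -/
theorem mem_convexHull_face {F : Type*} [AddCommGroup F] [Module ℝ F] (l : F →ₗ[ℝ] ℝ) (k : Set F)
    {x : F} (hx : x ∈ convexHull ℝ k) (hmax : ∀ v ∈ k, l v ≤ l x) :
    x ∈ convexHull ℝ {v ∈ k | l v = l x} := by
  have hk : k = {v ∈ k | l v = l x} ∪ {v ∈ k | l v < l x} := by
    ext v
    simp only [mem_union, mem_ofPred_eq]
    constructor
    · intro hv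
      rcases (hmax v hv).eq_or_lt with h | h
      · exact Or.inl ⟨hv, h⟩
      · exact Or.inr ⟨hv, h⟩
    · rintro (h | h) <;> exact h.1
  have h1 : ∀ y ∈ convexHull ℝ {v ∈ k | l v = l x}, l y = l x := fun y hy =>
    convexHull_min (t := {y | l y = l x}) (fun v hv => hv.2)
      (convex_hyperplane (r := l x) l.isLinear) hy
  have h2 : ∀ y ∈ convexHull ℝ {v ∈ k | l v < l x}, l y < l x := fun y hy =>
    convexHull_min (t := {y | l y < l x}) (fun v hv => hv.2)
      (convex_halfSpace_lt (r := l x) l.isLinear) hy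
  rcases eq_empty_or_nonempty {v ∈ k | l v < l x} with he | hne
  · rw [he, union_empty] at hk
    rwa [← hk]
  rcases eq_empty_or_nonempty {v ∈ k | l v = l x} with he' | hne'
  · rw [he', empty_union] at hk
    rw [hk] at hx
    exact absurd (h2 x hx) (lt_irrefl _)
  -- `x` is a convex combination of a point where `l` is maximal and one where it is strictly
  -- smaller; the latter must have weight zero.
  rw [hk, convexHull_union hne' hne, mem_convexJoin] at hx
  obtain ⟨a, ha, b, hb, s, t, hs, ht, hst, hab⟩ := hx
  have e : s * l a + t * l b = l x := by rw [← hab]; simp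
  rw [h1 a ha] at e
  have ht0 : t = 0 := by
    have e2 : t * (l x - l b) = 0 := by
      have : s = 1 - t := by linarith
      subst this
      linarith
    exact (mul_eq_zero.mp e2).resolve_right (sub_pos.mpr (h2 b hb)).ne'
  subst ht0
  have hs1 : s = 1 := by linarith
  rw [hs1, one_smul, zero_smul, add_zero] at hab
  exact hab ▸ ha

/-- The boundary of a convex polytope has finite surface measure. -/
theorem isFiniteMeasure_surf {d : ℕ} (hd : 0 < d) {Ω : Set (E d)} (hΩo : IsOpen Ω)
    (hΩc : Convex ℝ Ω) (hΩn : Ω.Nonempty) {T : Finset (Finset (E d))}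
    (hT : (⋃ k ∈ T, convexHull ℝ (k : Set (E d))) = closure Ω) : IsFiniteMeasure (surf Ω) := by
  obtain ⟨n, rfl⟩ : ∃ n, d = n + 1 := ⟨d - 1, by omega⟩
  refine ⟨?_⟩
  rw [surf, Measure.restrict_apply_univ, Nat.add_sub_cancel]
  let P : Finset (E (n + 1)) → Prop := fun F =>
    ∃ (l : StrongDual ℝ (E (n + 1))) (c : ℝ), l ≠ 0 ∧ ∀ v ∈ F, l v = c
  -- At a boundary point a supporting functional `l` is maximal over the closed domain, so the point
  -- lies in the hull of those vertices of its cell that attain the maximum. Indexing by vertex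
  -- subsets keeps the cover finite; `P` empties the pieces lying in no hyperplane.
  have hcov : frontier Ω ⊆ ⋃ k ∈ T, ⋃ F ∈ k.powerset, {x ∈ convexHull ℝ (F : Set (E (n + 1))) |
      P F} := by
    intro x hx
    have hxΩ : x ∉ Ω := by
      rw [hΩo.frontier_eq] at hx
      exact hx.2
    obtain ⟨l, hl⟩ := geometric_hahn_banach_open_point hΩc hΩo hxΩ
    have hle : ∀ y ∈ closure Ω, l y ≤ l x := fun y hy =>
      closure_minimal (t := {y | l y ≤ l x}) (fun y hy => (hl y hy).le)
        (isClosed_le l.continuous continuous_const) hy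
    have hl0 : l ≠ 0 := by
      rintro rfl
      obtain ⟨y, hy⟩ := hΩn
      simpa using hl y hy
    have hx' := frontier_subset_closure hx
    rw [← hT] at hx' hle
    simp only [mem_iUnion] at hx' ⊢
    obtain ⟨k, hk, hxk⟩ := hx'
    have := mem_convexHull_face l.toLinearMap (k : Set (E (n + 1))) hxk fun v hv =>
      hle v (mem_iUnion₂.mpr ⟨k, hk, subset_convexHull ℝ _ hv⟩)
    classical
    refine ⟨k, hk, k.filter fun v => l v = l x, by simp, ?_, l, l x, hl0, ?_⟩
    · simpa using this
    · intro v hv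
      exact (Finset.mem_filter.mp hv).2
  refine (measure_mono hcov).trans_lt ?_
  refine (measure_biUnion_lt_top T.finite_toSet fun k hk => ?_)
  refine (measure_biUnion_lt_top k.powerset.finite_toSet fun F hF => ?_)
  by_cases hP : P F
  · obtain ⟨l, c, hl, hlc⟩ := hP
    refine (measure_mono (sep_subset _ _)).trans_lt
      (hausdorff_lt_top_of_subset_hyperplane l hl c
        (isBounded_convexHull.mpr F.finite_toSet.isBounded) fun y hy => ?_)
    exact convexHull_min (t := {y | l y = c}) (fun v hv => hlc v hv)
      (convex_hyperplane (r := c) l.toLinearMap.isLinear) hy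
  · simp [hP]

end Poro

/-! ### Piecewise continuously differentiable functions on the mesh. -/

open Filter Topology in
/-- A continuous function on `[0, 1]` that is `C`-Lipschitz on each set of a finite closed cover
satisfies the Lipschitz estimate between the end points. -/
theorem norm_sub_le_of_finite_closed_cover {F ι : Type*} [NormedAddCommGroup F] (T : Finset ι)
    (S : ι → Set ℝ) (hS : ∀ k ∈ T, IsClosed (S k)) (hcov : Icc (0 : ℝ) 1 ⊆ ⋃ k ∈ T, S k)
    {φ : ℝ → F} (hφ : ContinuousOn φ (Icc 0 1)) {C : ℝ}
    (h : ∀ k ∈ T, ∀ s ∈ S k ∩ Icc 0 1, ∀ t ∈ S k ∩ Icc 0 1, ‖φ s - φ t‖ ≤ C * |s - t|) :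
    ‖φ 1 - φ 0‖ ≤ C := by
  have key := image_le_of_liminf_slope_right_le_deriv_boundary (f := fun t => ‖φ t - φ 0‖)
    (a := 0) (b := 1) (B := fun t => C * t) (B' := fun _ => C)
    (hφ.sub continuousOn_const).norm (by simp) (by fun_prop)
    (fun x _ => by simpa using ((hasDerivAt_id x).const_mul C).hasDerivWithinAt)
    (fun x hx r hr => by
      have hev : ∀ᶠ z in 𝓝[>] x, z ∈ Ioc x 1 := Ioc_mem_nhdsGT hx.2
      -- As the cover is finite, one set contains points arbitrarily close to `x` from the right,
      -- and by closedness also `x`. This bounds the lower right slope, which is all the mean value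
      -- inequality needs.
      have hk : ∃ k ∈ T, ∃ᶠ z in 𝓝[>] x, z ∈ S k := by
        by_contra! hcon
        have h1 : ∀ᶠ z in 𝓝[>] x, ∀ k ∈ T, z ∉ S k :=
          (eventually_all_finset T).mpr fun k hk => hcon k hk
        obtain ⟨z, hz1, hz2⟩ := (h1.and hev).exists
        have := hcov ⟨hx.1.trans hz2.1.le, hz2.2⟩
        simp only [mem_iUnion] at this
        obtain ⟨k, hk, hzk⟩ := this
        exact hz1 k hk hzk
      obtain ⟨k, hk, hfr⟩ := hk
      have hxk : x ∈ S k := by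
        rw [← (hS k hk).closure_eq]
        exact mem_closure_of_frequently_of_tendsto hfr
          (tendsto_id.mono_left nhdsWithin_le_nhds)
      refine (hfr.and_eventually hev).mono fun z hz => ?_
      refine lt_of_le_of_lt ?_ hr
      have hzx : 0 < z - x := sub_pos.mpr hz.2.1
      rw [slope_def_field, div_le_iff₀ hzx]
      have h1 := h k hk z ⟨hz.1, hx.1.trans hz.2.1.le, hz.2.2⟩ x ⟨hxk, hx.1, hx.2.le⟩
      rw [abs_of_pos hzx] at h1
      refine le_trans ?_ h1
      have := norm_sub_norm_le (φ z - φ 0) (φ x - φ 0)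
      simpa using this)
  simpa using key (right_mem_Icc.mpr zero_le_one)

namespace Poro

variable {d : ℕ} {F : Type*} [NormedAddCommGroup F] [NormedSpace ℝ F]

/-- The union of the open cells. -/
def openCells (T : Finset (Finset (E d))) : Set (E d) :=
  ⋃ k ∈ T, interior (convexHull ℝ (k : Set (E d)))

/-- Continuous, piecewise continuously differentiable functions on `closure Ω`, extended by
zero. -/
def feSpace (Ω : Set (E d)) (T : Finset (Finset (E d))) (F : Type*) [NormedAddCommGroup F]
    [NormedSpace ℝ F] : Submodule ℝ (E d → F) where
  carrier := {f | ContinuousOn f (closure Ω) ∧ (∀ x ∉ closure Ω, f x = 0) ∧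
    ∀ k ∈ T, ∃ P : E d → F, ContDiff ℝ 1 P ∧ EqOn f P (convexHull ℝ (k : Set (E d)))}
  add_mem' := by
    rintro f g ⟨hf1, hf2, hf3⟩ ⟨hg1, hg2, hg3⟩
    refine ⟨hf1.add hg1, fun x hx => by simp [hf2 x hx, hg2 x hx], fun k hk => ?_⟩
    obtain ⟨P, hP, hfP⟩ := hf3 k hk
    obtain ⟨Q, hQ, hgQ⟩ := hg3 k hk
    exact ⟨P + Q, hP.add hQ, fun x hx => by simp [hfP hx, hgQ hx]⟩
  zero_mem' := ⟨continuousOn_const, fun _ _ => rfl, fun _ _ => ⟨0, contDiff_const, fun _ _ => rfl⟩⟩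
  smul_mem' := by
    rintro c f ⟨hf1, hf2, hf3⟩
    refine ⟨hf1.const_smul c, fun x hx => by simp [hf2 x hx], fun k hk => ?_⟩
    obtain ⟨P, hP, hfP⟩ := hf3 k hk
    exact ⟨c • P, hP.const_smul c, fun x hx => by simp [hfP hx]⟩

variable {Ω : Set (E d)} {T : Finset (Finset (E d))}

theorem isCompact_cell (k : Finset (E d)) : IsCompact (convexHull ℝ (k : Set (E d))) :=
  k.finite_toSet.isCompact_convexHull ℝ

theorem exists_forall_le_of_finset {ι : Type*} (T : Finset ι) (p : ι → ℝ → Prop)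
    (hp : ∀ k a b, a ≤ b → p k a → p k b) (h : ∀ k ∈ T, ∃ c, p k c) :
    ∃ C : ℝ, 0 ≤ C ∧ ∀ k ∈ T, p k C := by
  choose! c hc using h
  refine ⟨∑ k ∈ T, |c k|, Finset.sum_nonneg fun _ _ => abs_nonneg _, fun k hk => ?_⟩
  exact hp k _ _ ((le_abs_self _).trans
    (Finset.single_le_sum (f := fun k => |c k|) (fun _ _ => abs_nonneg _) hk)) (hc k hk)

/-- Frontiers of convex sets are null. Hence derivatives, defined classically in the open cells,
determine all integrals over `Ω`. -/
theorem ae_mem_openCells (hT : (⋃ k ∈ T, convexHull ℝ (k : Set (E d))) = closure Ω)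
    (hΩo : IsOpen Ω) : ∀ᵐ x ∂(volume.restrict Ω), x ∈ openCells T := by
  rw [ae_restrict_iff' hΩo.measurableSet]
  have h : ∀ᵐ x : E d, ∀ k ∈ T, x ∉ frontier (convexHull ℝ (k : Set (E d))) := by
    rw [Filter.eventually_all_finset]
    exact fun k _ => measure_eq_zero_iff_ae_notMem.mp
      ((convex_convexHull ℝ _).addHaar_frontier volume)
  filter_upwards [h] with x hx hxΩ
  have hx' := subset_closure hxΩ
  rw [← hT] at hx'
  simp only [mem_iUnion, openCells] at hx' ⊢
  obtain ⟨k, hk, hxk⟩ := hx'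
  refine ⟨k, hk, ?_⟩
  by_contra hxi
  exact hx k hk ⟨subset_closure hxk, hxi⟩

theorem openCells_subset_closure (hT : (⋃ k ∈ T, convexHull ℝ (k : Set (E d))) = closure Ω) :
    openCells T ⊆ closure Ω := by
  rw [← hT]
  exact iUnion₂_mono fun _ _ => interior_subset

theorem isOpen_openCells : IsOpen (openCells T) := isOpen_biUnion fun _ _ => isOpen_interior

theorem exists_piece_of_mem_feSpace {f : E d → F} (hf : f ∈ feSpace Ω T F) {x : E d}
    (hx : x ∈ openCells T) : ∃ P : E d → F, ContDiff ℝ 1 P ∧ f =ᶠ[nhds x] P := by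
  simp only [openCells, mem_iUnion] at hx
  obtain ⟨k, hk, hxk⟩ := hx
  obtain ⟨P, hP, hfP⟩ := hf.2.2 k hk
  refine ⟨P, hP, ?_⟩
  filter_upwards [isOpen_interior.mem_nhds hxk] with y hy using hfP (interior_subset hy)

theorem differentiableAt_of_mem_feSpace {f : E d → F} (hf : f ∈ feSpace Ω T F) {x : E d}
    (hx : x ∈ openCells T) : DifferentiableAt ℝ f x := by
  obtain ⟨P, hP, hfP⟩ := exists_piece_of_mem_feSpace hf hx
  exact (hP.differentiable one_ne_zero x).congr_of_eventuallyEq hfP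

theorem continuousAt_fderiv_of_mem_feSpace {f : E d → F} (hf : f ∈ feSpace Ω T F) {x : E d}
    (hx : x ∈ openCells T) : ContinuousAt (fderiv ℝ f) x := by
  obtain ⟨P, hP, hfP⟩ := exists_piece_of_mem_feSpace hf hx
  exact (hP.continuous_fderiv one_ne_zero).continuousAt.congr hfP.fderiv.symm

theorem exists_bound_of_mem_feSpace (hΩb : Bornology.IsBounded Ω) {f : E d → F}
    (hf : f ∈ feSpace Ω T F) : ∃ C : ℝ, ∀ x ∈ closure Ω, ‖f x‖ ≤ C :=
  hΩb.isCompact_closure.exists_bound_of_continuousOn hf.1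

theorem exists_fderiv_bound_of_mem_feSpace {f : E d → F} (hf : f ∈ feSpace Ω T F) :
    ∃ C : ℝ, ∀ x ∈ openCells T, ‖fderiv ℝ f x‖ ≤ C := by
  obtain ⟨C, -, hC⟩ := exists_forall_le_of_finset T
    (fun k C => ∀ x ∈ interior (convexHull ℝ (k : Set (E d))), ‖fderiv ℝ f x‖ ≤ C)
    (fun k a b hab h x hx => (h x hx).trans hab) fun k hk => by
      obtain ⟨P, hP, hfP⟩ := hf.2.2 k hk
      obtain ⟨C, hC⟩ := (isCompact_cell k).exists_bound_of_continuousOn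
        (hP.continuous_fderiv one_ne_zero).continuousOn
      refine ⟨C, fun x hx => ?_⟩
      have : f =ᶠ[nhds x] P := by
        filter_upwards [isOpen_interior.mem_nhds hx] with y hy using hfP (interior_subset hy)
      rw [this.fderiv_eq]
      exact hC x (interior_subset hx)
  refine ⟨C, fun x hx => ?_⟩
  simp only [openCells, mem_iUnion] at hx
  obtain ⟨k, hk, hxk⟩ := hx
  exact hC k hk x hxk

/-- Finite element functions are Lipschitz on convex domains. -/
theorem exists_lipschitz_of_mem_feSpace
    (hT : (⋃ k ∈ T, convexHull ℝ (k : Set (E d))) = closure Ω) (hΩc : Convex ℝ Ω)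
    {f : E d → F} (hf : f ∈ feSpace Ω T F) :
    ∃ C : ℝ, 0 ≤ C ∧ ∀ x ∈ closure Ω, ∀ y ∈ closure Ω, ‖f y - f x‖ ≤ C * ‖y - x‖ := by
  obtain ⟨C, hC0, hC⟩ := exists_forall_le_of_finset T
    (fun k C => ∀ x ∈ convexHull ℝ (k : Set (E d)), ∀ y ∈ convexHull ℝ (k : Set (E d)),
      ‖f y - f x‖ ≤ C * ‖y - x‖)
    (fun k a b hab h x hx y hy => (h x hx y hy).trans
      (mul_le_mul_of_nonneg_right hab (norm_nonneg _))) fun k hk => by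
      obtain ⟨P, hP, hfP⟩ := hf.2.2 k hk
      obtain ⟨C, hC⟩ := (isCompact_cell k).exists_bound_of_continuousOn
        (hP.continuous_fderiv one_ne_zero).continuousOn
      refine ⟨C, fun x hx y hy => ?_⟩
      rw [hfP hx, hfP hy]
      exact (convex_convexHull ℝ _).norm_image_sub_le_of_norm_fderiv_le
        (fun z _ => hP.differentiable one_ne_zero z) hC hx hy
  refine ⟨C, hC0, fun x hx y hy => ?_⟩
  have hline : ∀ t ∈ Icc (0 : ℝ) 1, AffineMap.lineMap x y t ∈ closure Ω := fun t ht =>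
    hΩc.closure.lineMap_mem hx hy ht
  have hcont : Continuous fun t : ℝ => (AffineMap.lineMap x y t : E d) :=
    AffineMap.lineMap_continuous
  -- By convexity the segment stays in the closed domain, and the cells cut it into finitely many
  -- closed pieces.
  have := norm_sub_le_of_finite_closed_cover T
    (fun k => (fun t : ℝ => (AffineMap.lineMap x y t : E d)) ⁻¹' convexHull ℝ (k : Set (E d)))
    (fun k _ => (isCompact_cell k).isClosed.preimage hcont)
    (fun t ht => by
      have := hline t ht
      rw [← hT] at this
      simpa using this)
    (φ := fun t => f (AffineMap.lineMap x y t)) (hf.1.comp hcont.continuousOn hline)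
    (C := C * ‖y - x‖)
    (fun k hk s hs t ht => by
      refine (hC k hk _ ht.1 _ hs.1).trans (le_of_eq ?_)
      have : (AffineMap.lineMap x y s : E d) - AffineMap.lineMap x y t = (s - t) • (y - x) := by
        simp only [AffineMap.lineMap_apply, vsub_eq_sub, vadd_eq_add]; module
      rw [this, norm_smul, Real.norm_eq_abs]
      ring)
  simpa using this

theorem memLp_of_mem_feSpace (hΩb : Bornology.IsBounded Ω) {f : E d → F}
    (hf : f ∈ feSpace Ω T F) (ν : Measure (E d)) {S : Set (E d)} (hS : MeasurableSet S)
    (hSΩ : S ⊆ closure Ω) [IsFiniteMeasure (ν.restrict S)] [SecondCountableTopology F]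
    (p : ENNReal) : MemLp f p (ν.restrict S) := by
  obtain ⟨C, hC⟩ := exists_bound_of_mem_feSpace hΩb hf
  exact MemLp.of_bound ((hf.1.mono hSΩ).aestronglyMeasurable hS) C
    ((ae_restrict_mem hS).mono fun x hx => hC x (hSΩ hx))

theorem memLp_fderiv_of_mem_feSpace [FiniteDimensional ℝ F]
    (hT : (⋃ k ∈ T, convexHull ℝ (k : Set (E d))) = closure Ω) (hΩo : IsOpen Ω)
    (hΩb : Bornology.IsBounded Ω) {f : E d → F} (hf : f ∈ feSpace Ω T F) (p : ENNReal) :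
    MemLp (fderiv ℝ f) p (volume.restrict Ω) := by
  obtain ⟨C, hC⟩ := exists_fderiv_bound_of_mem_feSpace hf
  have : CompleteSpace F := FiniteDimensional.complete ℝ F
  have : IsFiniteMeasure (volume.restrict Ω) := isFiniteMeasure_restrict.mpr hΩb.measure_lt_top.ne
  have : ProperSpace (E d →L[ℝ] F) := FiniteDimensional.proper ℝ _
  exact MemLp.of_bound (measurable_fderiv ℝ f).stronglyMeasurable.aestronglyMeasurable C
    ((ae_mem_openCells hT hΩo).mono hC)

theorem fderiv_add_of_mem_feSpace {f g : E d → F} (hf : f ∈ feSpace Ω T F)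
    (hg : g ∈ feSpace Ω T F) {x : E d} (hx : x ∈ openCells T) :
    fderiv ℝ (f + g) x = fderiv ℝ f x + fderiv ℝ g x :=
  fderiv_add (differentiableAt_of_mem_feSpace hf hx) (differentiableAt_of_mem_feSpace hg hx)

theorem fderiv_smul_of_mem_feSpace {f : E d → F} (hf : f ∈ feSpace Ω T F) (c : ℝ) {x : E d}
    (hx : x ∈ openCells T) : fderiv ℝ (c • f) x = c • fderiv ℝ f x :=
  fderiv_const_smul (differentiableAt_of_mem_feSpace hf hx) c

end Poro

/-! ### Discrete functions and their derivatives in `L²`. -/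

/-- The `L²` inner product is the integral of the pointwise inner product. -/
theorem L2_inner_eq_integral {α X : Type*} [MeasurableSpace α] {ν : Measure α}
    [NormedAddCommGroup X] [InnerProductSpace ℝ X] {F G : Lp X 2 ν} {f g : α → X}
    (hF : F =ᵐ[ν] f) (hG : G =ᵐ[ν] g) : inner ℝ F G = ∫ x, inner ℝ (f x) (g x) ∂ν := by
  rw [L2.inner_def]
  refine integral_congr_ae ?_
  filter_upwards [hF, hG] with x h1 h2
  rw [h1, h2]

/-- A linear map into `L²` from an almost everywhere linear family of functions. -/
theorem exists_linearMap_toLp {α X V : Type*} [MeasurableSpace α] {ν : Measure α}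
    [NormedAddCommGroup X] [NormedSpace ℝ X] [AddCommGroup V] [Module ℝ V]
    (Φ : V → α → X) (hmem : ∀ v, MemLp (Φ v) 2 ν)
    (hadd : ∀ u v, ∀ᵐ x ∂ν, Φ (u + v) x = Φ u x + Φ v x)
    (hsmul : ∀ (c : ℝ) v, ∀ᵐ x ∂ν, Φ (c • v) x = c • Φ v x) :
    ∃ D : V →ₗ[ℝ] Lp X 2 ν, ∀ v, D v =ᵐ[ν] Φ v := by
  refine ⟨{ toFun := fun v => (hmem v).toLp _
            map_add' := fun u v => ?_
            map_smul' := fun c v => ?_ }, fun v => (hmem v).coeFn_toLp⟩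
  · rw [← MemLp.toLp_add]
    exact (MemLp.toLp_eq_toLp_iff _ _).mpr (hadd u v)
  · rw [RingHom.id_apply, ← MemLp.toLp_const_smul]
    exact (MemLp.toLp_eq_toLp_iff _ _).mpr (hsmul c v)

namespace Poro

variable {d : ℕ} {F : Type*} [NormedAddCommGroup F] [NormedSpace ℝ F]
variable {Ω : Set (E d)} {T : Finset (Finset (E d))}

/-- Finite element functions as elements of `L²`. -/
theorem exists_value_map [SecondCountableTopology F] (hΩb : Bornology.IsBounded Ω)
    (ν : Measure (E d)) {S : Set (E d)}
    (hS : MeasurableSet S) (hSΩ : S ⊆ closure Ω) [IsFiniteMeasure (ν.restrict S)] :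
    ∃ D : feSpace Ω T F →ₗ[ℝ] Lp F 2 (ν.restrict S),
      ∀ f, D f =ᵐ[ν.restrict S] (f : E d → F) :=
  exists_linearMap_toLp (fun f : feSpace Ω T F => (f : E d → F))
    (fun f => memLp_of_mem_feSpace hΩb f.2 ν hS hSΩ 2)
    (fun _ _ => Filter.Eventually.of_forall fun _ => rfl)
    fun _ _ => Filter.Eventually.of_forall fun _ => rfl

/-- First order differential operators on finite element functions. -/
theorem exists_derivative_map [FiniteDimensional ℝ F]
    (hT : (⋃ k ∈ T, convexHull ℝ (k : Set (E d))) = closure Ω) (hΩo : IsOpen Ω)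
    (hΩb : Bornology.IsBounded Ω) {X : Type*} [NormedAddCommGroup X] [NormedSpace ℝ X]
    (B : (E d →L[ℝ] F) →L[ℝ] X) :
    ∃ D : feSpace Ω T F →ₗ[ℝ] Lp X 2 (volume.restrict Ω),
      ∀ f, D f =ᵐ[volume.restrict Ω] fun x => B (fderiv ℝ (f : E d → F) x) :=
  exists_linearMap_toLp (fun (f : feSpace Ω T F) x => B (fderiv ℝ (f : E d → F) x))
    (fun f => (memLp_fderiv_of_mem_feSpace hT hΩo hΩb f.2 2).continuousLinearMap_comp B)
    (fun f g => (ae_mem_openCells hT hΩo).mono fun x hx => by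
      rw [← map_add, ← fderiv_add_of_mem_feSpace f.2 g.2 hx]; rfl)
    fun c f => (ae_mem_openCells hT hΩo).mono fun x hx => by
      rw [← map_smul, ← fderiv_smul_of_mem_feSpace f.2 c hx]; rfl

/-- The gradient as a vector, as a function of the derivative. -/
noncomputable def gradL (d : ℕ) : (E d →L[ℝ] ℝ) →L[ℝ] E d := LinearMap.toContinuousLinearMap
  { toFun := fun L => WithLp.toLp 2 fun j => L (EuclideanSpace.single j 1)
    map_add' := fun _ _ => rfl
    map_smul' := fun _ _ => rfl }

/-- The strain as a function of the derivative. -/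
noncomputable def strainL (d : ℕ) : (E d →L[ℝ] E d) →L[ℝ] FrobSpace d :=
  LinearMap.toContinuousLinearMap
  { toFun := fun L => WithLp.toLp 2 fun p => (1 / 2 : ℝ) *
      (L (EuclideanSpace.single p.2 1) p.1 + L (EuclideanSpace.single p.1 1) p.2)
    map_add' := fun L M => by
      ext p; simp; ring
    map_smul' := fun c L => by
      ext p; simp; ring }

theorem strainL_fderiv (u : E d → E d) (x : E d) :
    strainL d (fderiv ℝ u x) = toFrob (strain u x) := by
  ext p
  simp [strainL, toFrob, strain, jac]

/-- The divergence as a function of the derivative. -/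
noncomputable def divL (d : ℕ) : (E d →L[ℝ] E d) →L[ℝ] ℝ :=
  (innerSL ℝ (toFrob (1 : Matrix (Fin d) (Fin d) ℝ))) ∘L strainL d

theorem divL_fderiv (u : E d → E d) (x : E d) : divL d (fderiv ℝ u x) = divg u x := by
  rw [divL, ContinuousLinearMap.comp_apply, strainL_fderiv, innerSL_apply_apply, inner_toFrob_one,
    trace_strain]

/-- The quadratic form at `e_i` bounds the diagonal; at `e_i + e_j` it then bounds the other entries
by `K₂ - K₁`. Thus `K` is bounded and `K ∇q` stays in `L²`. -/
theorem abs_entry_le_of_quadratic_bounds {A : Matrix (Fin d) (Fin d) ℝ} (hA : A.IsSymm)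
    {K₁ K₂ : ℝ} (hK₁ : 0 < K₁)
    (h : ∀ z : Fin d → ℝ, K₁ * (z ⬝ᵥ z) ≤ A.mulVec z ⬝ᵥ z ∧ A.mulVec z ⬝ᵥ z ≤ K₂ * (z ⬝ᵥ z))
    (i j : Fin d) : |A i j| ≤ K₂ := by
  have hdiag : ∀ i, K₁ ≤ A i i ∧ A i i ≤ K₂ := fun i => by
    have := h (Pi.single i 1)
    simpa using this
  by_cases hij : i = j
  · subst hij
    rw [abs_of_nonneg (hK₁.le.trans (hdiag i).1)]
    exact (hdiag i).2
  · have h1 := h (Pi.single i 1 + Pi.single j 1)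
    simp only [Matrix.mulVec_add, Pi.add_apply, dotProduct_add, Matrix.mulVec_single_one,
      dotProduct_single, mul_one, Matrix.col_apply, Pi.single_eq_same, Pi.single_eq_of_ne hij,
      Pi.single_eq_of_ne (Ne.symm hij), hA.apply i j] at h1
    have h2 := hdiag i
    have h3 := hdiag j
    rw [abs_le]
    constructor <;> linarith [h1.1, h1.2]

theorem Material.IsAdmissible.memLp_K_mulVec {m : Material d} (hm : m.IsAdmissible Ω)
    {w : E d → Fin d → ℝ}
    (hw : MemLp (fun x => (WithLp.toLp 2 (w x) : E d)) 2 (volume.restrict Ω)) :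
    MemLp (fun x => (WithLp.toLp 2 ((m.K x).mulVec (w x)) : E d)) 2 (volume.restrict Ω) := by
  obtain ⟨K₁, K₂, h1, -, hK⟩ := hm.K_bounds
  refine MemLp.of_eval_piLp fun i => ?_
  have hsum : ∀ j ∈ (Finset.univ : Finset (Fin d)),
      MemLp (fun x => m.K x i j * w x j) 2 (volume.restrict Ω) := fun j _ => by
    have hKij : MemLp (fun x => m.K x i j) ⊤ (volume.restrict Ω) := by
      refine memLp_top_of_bound (hm.K_meas i j).aestronglyMeasurable K₂ ?_
      filter_upwards [hK, hm.K_symm] with x hx hs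
      exact abs_entry_le_of_quadratic_bounds hs h1 hx i j
    exact MemLp.mul' (p := ⊤) (q := 2) (r := 2) (hw.eval_piLp j) hKij
  exact (memLp_finsetSum _ hsum)

end Poro

/-- The inner product of real numbers. -/
theorem real_inner_eq_mul (a b : ℝ) : inner ℝ a b = a * b := by simp [mul_comm]

namespace Poro

variable {d : ℕ} {F : Type*} [NormedAddCommGroup F] [NormedSpace ℝ F]
variable {Ω : Set (E d)} {T : Finset (Finset (E d))}

/-- A convex open set is the interior of its closure. -/
theorem openCells_subset (hT : (⋃ k ∈ T, convexHull ℝ (k : Set (E d))) = closure Ω)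
    (hΩo : IsOpen Ω) (hΩc : Convex ℝ Ω) (hΩn : Ω.Nonempty) : openCells T ⊆ Ω := by
  have h : interior (closure Ω) = Ω := by
    rw [hΩc.interior_closure_eq_interior_of_nonempty_interior (by rwa [hΩo.interior_eq]),
      hΩo.interior_eq]
  rw [← h]
  exact interior_maximal (openCells_subset_closure hT) isOpen_openCells

/-- The open cells have full measure, so they are dense in `Ω`. Strains are known only inside the
cells, and this carries the information to the whole closed domain. -/
theorem closure_subset_iUnion_closure_interior
    (hT : (⋃ k ∈ T, convexHull ℝ (k : Set (E d))) = closure Ω) (hΩo : IsOpen Ω) :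
    closure Ω ⊆ ⋃ k ∈ T, closure (interior (convexHull ℝ (k : Set (E d)))) := by
  have h : (⋃ k ∈ T, closure (interior (convexHull ℝ (k : Set (E d))))) = closure (openCells T) :=
    (T.closure_biUnion _).symm
  rw [h]
  refine closure_minimal (fun x hx => ?_) isClosed_closure
  by_contra hx'
  have hU : IsOpen (Ω ∩ (closure (openCells T))ᶜ) := hΩo.inter isClosed_closure.isOpen_compl
  have h0 := hU.measure_pos volume ⟨x, hx, hx'⟩
  have h1 := ae_mem_openCells hT hΩo
  rw [ae_restrict_iff' hΩo.measurableSet] at h1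
  refine h0.ne' (measure_mono_null ?_ (ae_iff.mp h1))
  intro y hy
  simp only [Classical.not_imp, mem_ofPred_eq]
  exact ⟨hy.1, fun h => hy.2 (subset_closure h)⟩

/-- Definiteness of the mass form. Extension by zero makes this an equality of functions on all of
`ℝ^d`. -/
theorem eq_zero_of_mem_feSpace (hΩo : IsOpen Ω) {f : E d → F} (hf : f ∈ feSpace Ω T F)
    (h : ∀ᵐ x ∂(volume.restrict Ω), f x = 0) : f = 0 := by
  have h1 : EqOn f 0 Ω := Measure.eqOn_open_of_ae_eq (μ := volume) h hΩo
    (hf.1.mono subset_closure) continuousOn_const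
  have h2 : EqOn f 0 (closure Ω) :=
    h1.of_subset_closure hf.1 continuousOn_const subset_closure subset_rfl
  funext x
  by_cases hx : x ∈ closure Ω
  · exact h2 hx
  · exact hf.2.1 x hx

/-! ### The discrete spaces -/

theorem contDiff_eval_mvPolynomial (p : MvPolynomial (Fin d) ℝ) {n : WithTop ℕ∞} :
    ContDiff ℝ n fun x : E d => MvPolynomial.eval (fun i => x i) p := by
  induction p using MvPolynomial.induction_on with
  | C a => simpa using contDiff_const
  | add p q hp hq => simpa using hp.add hq
  | mul_X p i hp =>
    simp only [map_mul, MvPolynomial.eval_X]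
    exact hp.mul (by fun_prop)

theorem lagrange_subset_feSpace {r : ℕ} : lagrange Ω T r ⊆ feSpace Ω T ℝ := by
  rintro q ⟨h1, h2, h3⟩
  refine ⟨h1, h2, fun k hk => ?_⟩
  obtain ⟨p, -, hp⟩ := h3 k hk
  exact ⟨_, contDiff_eval_mvPolynomial p, hp⟩

theorem Xh_subset_feSpace : Xh Ω T ⊆ feSpace Ω T (E d) := by
  intro v hv
  have hv' := fun i => lagrange_subset_feSpace (hv i)
  refine ⟨?_, fun x hx => ?_, fun k hk => ?_⟩
  · have h : ContinuousOn (fun x i => v x i) (closure Ω) := continuousOn_pi.mpr fun i => (hv' i).1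
    exact (PiLp.continuous_toLp 2 _).comp_continuousOn h
  · ext i
    exact (hv' i).2.1 x hx
  · choose P hP using fun i => (hv' i).2.2 k hk
    refine ⟨fun x => WithLp.toLp 2 fun i => P i x, ?_, fun x hx => ?_⟩
    · rw [contDiff_euclidean]
      exact fun i => (hP i).1
    · ext i
      exact (hP i).2 hx

/-- The scalar Lagrange space as a vector space. -/
def lagrangeSpace (Ω : Set (E d)) (T : Finset (Finset (E d))) (r : ℕ) :
    Submodule ℝ (E d → ℝ) where
  carrier := lagrange Ω T r
  add_mem' := by
    rintro f g ⟨hf1, hf2, hf3⟩ ⟨hg1, hg2, hg3⟩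
    refine ⟨hf1.add hg1, fun x hx => by simp [hf2 x hx, hg2 x hx], fun k hk => ?_⟩
    obtain ⟨p, hp, hfp⟩ := hf3 k hk
    obtain ⟨q, hq, hgq⟩ := hg3 k hk
    exact ⟨p + q, (MvPolynomial.totalDegree_add p q).trans (max_le hp hq),
      fun x hx => by simp [hfp x hx, hgq x hx]⟩
  zero_mem' := ⟨continuousOn_const, fun _ _ => rfl, fun _ _ => ⟨0, by simp, fun _ _ => by simp⟩⟩
  smul_mem' := by
    rintro c f ⟨hf1, hf2, hf3⟩
    refine ⟨hf1.const_smul c, fun x hx => by simp [hf2 x hx], fun k hk => ?_⟩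
    obtain ⟨p, hp, hfp⟩ := hf3 k hk
    exact ⟨c • p, (MvPolynomial.totalDegree_smul_le c p).trans hp,
      fun x hx => by simp [hfp x hx]⟩

theorem finiteDimensional_lagrangeSpace
    (hT : (⋃ k ∈ T, convexHull ℝ (k : Set (E d))) = closure Ω) (r : ℕ) :
    FiniteDimensional ℝ (lagrangeSpace Ω T r) := by
  classical
  have hsel : ∀ x : E d, x ∈ closure Ω → ∃ k ∈ T, x ∈ convexHull ℝ (k : Set (E d)) := fun x hx => by
    rw [← hT] at hx
    simpa using hx
  -- Choosing one cell for each point turns a family of polynomials, one per cell, into a function;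
  -- the range of this linear map contains the Lagrange space.
  choose! sel hsel1 hsel2 using hsel
  let Φ : (T → MvPolynomial.restrictTotalDegree (Fin d) ℝ r) →ₗ[ℝ] (E d → ℝ) :=
    { toFun := fun p x => if h : x ∈ closure Ω then
        MvPolynomial.eval (fun i => x i) (p ⟨sel x, hsel1 x h⟩ : MvPolynomial (Fin d) ℝ) else 0
      map_add' := fun p q => by
        funext x
        by_cases h : x ∈ closure Ω <;> simp [h]
      map_smul' := fun c p => by
        funext x
        by_cases h : x ∈ closure Ω <;> simp [h] }
  have hle : lagrangeSpace Ω T r ≤ LinearMap.range Φ := by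
    rintro q ⟨h1, h2, h3⟩
    choose p hp hqp using h3
    refine ⟨fun k => ⟨p k k.2, (MvPolynomial.mem_restrictTotalDegree _ _ _).mpr (hp k k.2)⟩, ?_⟩
    funext x
    by_cases h : x ∈ closure Ω
    · simp only [Φ, LinearMap.coe_mk, AddHom.coe_mk, dif_pos h]
      exact (hqp _ _ x (hsel2 x h)).symm
    · simp [Φ, h, h2 x h]
  exact Submodule.finiteDimensional_of_le hle

/-- `X_h` as a vector space. -/
def XhSpace (Ω : Set (E d)) (T : Finset (Finset (E d))) : Submodule ℝ (E d → E d) where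
  carrier := Xh Ω T
  add_mem' := fun hf hg i => (lagrangeSpace Ω T 2).add_mem (hf i) (hg i)
  zero_mem' := fun _ => (lagrangeSpace Ω T 2).zero_mem
  smul_mem' := fun c _ hf i => (lagrangeSpace Ω T 2).smul_mem c (hf i)

theorem finiteDimensional_XhSpace
    (hT : (⋃ k ∈ T, convexHull ℝ (k : Set (E d))) = closure Ω) :
    FiniteDimensional ℝ (XhSpace Ω T) := by
  have := finiteDimensional_lagrangeSpace hT 2
  let Φ : XhSpace Ω T →ₗ[ℝ] (Fin d → lagrangeSpace Ω T 2) :=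
    { toFun := fun v i => ⟨fun x => (v : E d → E d) x i, v.2 i⟩
      map_add' := fun _ _ => rfl
      map_smul' := fun _ _ => rfl }
  refine FiniteDimensional.of_injective Φ fun v w h => ?_
  ext x i
  exact congrFun (congrArg Subtype.val (congrFun h i)) x

theorem continuous_of_mem_rigidMotions {r : E d → E d} (hr : r ∈ rigidMotions d) :
    Continuous r := by
  obtain ⟨a, B, -, h⟩ := hr
  have : Continuous fun x i => r x i := by
    simp only [h, Matrix.mulVec, dotProduct]
    fun_prop
  exact (PiLp.continuous_toLp 2 _).comp this

theorem integrable_inner_rigidMotion (hΩb : Bornology.IsBounded Ω)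
    {v r : E d → E d} (hv : v ∈ feSpace Ω T (E d)) (hr : r ∈ rigidMotions d) :
    Integrable (fun x => inner ℝ (v x) (r x)) (volume.restrict Ω) := by
  have h : ContinuousOn (fun x => inner ℝ (v x) (r x)) (closure Ω) :=
    hv.1.inner (continuous_of_mem_rigidMotions hr).continuousOn
  exact (h.integrableOn_compact hΩb.isCompact_closure).mono_set subset_closure

/-- `V_h` as a vector space. -/
def VhSpace (T : Finset (Finset (E d))) (hΩb : Bornology.IsBounded Ω) :
    Submodule ℝ (E d → E d) where
  carrier := Vh Ω T
  add_mem' := fun {u v} hu hv => ⟨(XhSpace Ω T).add_mem hu.1 hv.1, fun r hr => by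
    simp only [Pi.add_apply, inner_add_left]
    rw [integral_add (integrable_inner_rigidMotion hΩb (Xh_subset_feSpace hu.1) hr)
      (integrable_inner_rigidMotion hΩb (Xh_subset_feSpace hv.1) hr), hu.2 r hr, hv.2 r hr,
      add_zero]⟩
  zero_mem' := ⟨(XhSpace Ω T).zero_mem, fun r _ => by simp⟩
  smul_mem' := fun c u hu => ⟨(XhSpace Ω T).smul_mem c hu.1, fun r hr => by
    simp only [Pi.smul_apply, real_inner_smul_left]
    rw [integral_const_mul, hu.2 r hr, mul_zero]⟩

theorem finiteDimensional_VhSpace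
    (hT : (⋃ k ∈ T, convexHull ℝ (k : Set (E d))) = closure Ω)
    (hΩb : Bornology.IsBounded Ω) : FiniteDimensional ℝ (VhSpace T hΩb) := by
  have := finiteDimensional_XhSpace hT
  exact Submodule.finiteDimensional_of_le (S₂ := XhSpace Ω T) fun v hv => hv.1

/-! ### Rigidity -/

/-- Zero strain means that the matrix of `L` is skew-symmetric. -/
theorem inner_apply_self_eq_zero_of_strainL {L : E d →L[ℝ] E d} (hL : strainL d L = 0) (z : E d) :
    inner ℝ (L z) z = 0 := by
  have hz : z = ∑ j, z j • EuclideanSpace.single j (1 : ℝ) := by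
    ext i
    simp [Finset.sum_apply, Pi.single_apply]
  have hS : ∀ i j, L (EuclideanSpace.single j 1) i + L (EuclideanSpace.single i 1) j = 0 :=
    fun i j => by
      have := congrFun (congrArg WithLp.ofLp hL) (i, j)
      simp [strainL] at this
      exact this
  have e : inner ℝ (L z) z = ∑ i, ∑ j, z i * z j * L (EuclideanSpace.single j 1) i := by
    rw [PiLp.inner_apply]
    refine Finset.sum_congr rfl fun i _ => ?_
    have : L z i = ∑ j, z j * L (EuclideanSpace.single j 1) i := by
      conv_lhs => rw [hz]
      simp
    rw [this, real_inner_eq_mul, Finset.sum_mul]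
    exact Finset.sum_congr rfl fun j _ => by ring
  have e' : inner ℝ (L z) z = ∑ i, ∑ j, z i * z j * L (EuclideanSpace.single i 1) j := by
    rw [e, Finset.sum_comm]
    exact Finset.sum_congr rfl fun i _ => Finset.sum_congr rfl fun j _ => by ring
  have : inner ℝ (L z) z + inner ℝ (L z) z = 0 := by
    nth_rewrite 1 [e]
    rw [e', ← Finset.sum_add_distrib]
    refine Finset.sum_eq_zero fun i _ => ?_
    rw [← Finset.sum_add_distrib]
    refine Finset.sum_eq_zero fun j _ => ?_
    rw [← mul_add, hS, mul_zero]
  linarith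

/-- A vector field with vanishing strain on a convex open set. -/
theorem inner_sub_eq_zero_of_strainL {P : E d → E d} (hP : Differentiable ℝ P) {U : Set (E d)}
    (hU : Convex ℝ U) (h : ∀ x ∈ U, strainL d (fderiv ℝ P x) = 0) {x y : E d} (hx : x ∈ U)
    (hy : y ∈ U) : inner ℝ (P y - P x) (y - x) = 0 := by
  let φ : ℝ → ℝ := fun t => inner ℝ (P (AffineMap.lineMap x y t)) (y - x)
  have hd : ∀ t, HasDerivAt φ
      (inner ℝ (fderiv ℝ P (AffineMap.lineMap x y t) (y - x)) (y - x)) t := fun t => by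
    have h1 : HasDerivAt (fun t => P (AffineMap.lineMap x y t))
        (fderiv ℝ P (AffineMap.lineMap x y t) (y - x)) t :=
      (hP _).hasFDerivAt.comp_hasDerivAt t AffineMap.hasDerivAt_lineMap
    simpa using h1.inner ℝ (hasDerivAt_const t (y - x))
  have := (convex_Icc (0 : ℝ) 1).norm_image_sub_le_of_norm_hasDerivWithin_le (f := φ) (C := 0)
    (fun t _ => (hd t).hasDerivWithinAt) (fun t ht => by
      rw [inner_apply_self_eq_zero_of_strainL (h _ (hU.lineMap_mem hx hy ht)), norm_zero])
    (left_mem_Icc.mpr zero_le_one) (right_mem_Icc.mpr zero_le_one)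
  rw [zero_mul, norm_le_zero_iff] at this
  simpa [φ, inner_sub_left] using this

/-- A finite element vector field with vanishing strain is an infinitesimal isometry. -/
theorem inner_sub_eq_zero_of_strain (hT : (⋃ k ∈ T, convexHull ℝ (k : Set (E d))) = closure Ω)
    (hΩo : IsOpen Ω) (hΩc : Convex ℝ Ω) (hΩn : Ω.Nonempty) {u : E d → E d}
    (hu : u ∈ feSpace Ω T (E d))
    (h : ∀ᵐ x ∂(volume.restrict Ω), strainL d (fderiv ℝ u x) = 0) {x y : E d}
    (hx : x ∈ closure Ω) (hy : y ∈ closure Ω) : inner ℝ (u y - u x) (y - x) = 0 := by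
  -- The derivative is continuous on the open cells, so the strain vanishes there everywhere.
  have h0 : EqOn (fun x => strainL d (fderiv ℝ u x)) 0 (openCells T) :=
    Measure.eqOn_open_of_ae_eq (μ := volume)
      (ae_restrict_of_ae_restrict_of_subset (openCells_subset hT hΩo hΩc hΩn) h)
      isOpen_openCells (fun x hx => ((strainL d).continuous.continuousAt.comp
        (continuousAt_fderiv_of_mem_feSpace hu hx)).continuousWithinAt) continuousOn_const
  have hcell : ∀ k ∈ T, ∀ x ∈ closure (interior (convexHull ℝ (k : Set (E d)))),
      ∀ y ∈ closure (interior (convexHull ℝ (k : Set (E d)))),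
      inner ℝ (u y - u x) (y - x) = 0 := by
    intro k hk x hx y hy
    obtain ⟨P, hP, huP⟩ := hu.2.2 k hk
    have hsub : closure (interior (convexHull ℝ (k : Set (E d)))) ⊆ convexHull ℝ (k : Set (E d)) :=
      closure_minimal interior_subset (isCompact_cell k).isClosed
    rw [huP (hsub hx), huP (hsub hy)]
    have hint : ∀ p ∈ interior (convexHull ℝ (k : Set (E d))) ×ˢ
        interior (convexHull ℝ (k : Set (E d))), inner ℝ (P p.2 - P p.1) (p.2 - p.1) = 0 := by
      rintro ⟨x, y⟩ ⟨hx, hy⟩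
      refine inner_sub_eq_zero_of_strainL (hP.differentiable one_ne_zero)
        (convex_convexHull ℝ _).interior (fun z hz => ?_) hx hy
      have : u =ᶠ[nhds z] P := by
        filter_upwards [isOpen_interior.mem_nhds hz] with y hy using huP (interior_subset hy)
      rw [← this.fderiv_eq]
      exact h0 (mem_biUnion (x := k) hk hz)
    have hclosed : IsClosed {p : E d × E d | inner ℝ (P p.2 - P p.1) (p.2 - p.1) = (0 : ℝ)} := by
      have := hP.continuous
      exact isClosed_eq (by fun_prop) continuous_const
    have hmem := closure_minimal (fun p hp => hint p hp) hclosed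
    rw [closure_prod_eq] at hmem
    exact hmem (mk_mem_prod hx hy)
  have hline : ∀ t ∈ Icc (0 : ℝ) 1, AffineMap.lineMap x y t ∈ closure Ω := fun t ht =>
    hΩc.closure.lineMap_mem hx hy ht
  have hcont : Continuous fun t : ℝ => (AffineMap.lineMap x y t : E d) :=
    AffineMap.lineMap_continuous
  -- On each closed cell the component of `u` along the segment is constant, so the cover lemma with
  -- constant `0` makes it constant on the whole segment.
  have := norm_sub_le_of_finite_closed_cover T
    (fun k => (fun t : ℝ => (AffineMap.lineMap x y t : E d)) ⁻¹'
      closure (interior (convexHull ℝ (k : Set (E d)))))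
    (fun k _ => isClosed_closure.preimage hcont)
    (fun t ht => by
      have := closure_subset_iUnion_closure_interior hT hΩo (hline t ht)
      simpa using this)
    (φ := fun t => inner ℝ (u (AffineMap.lineMap x y t)) (y - x))
    ((hu.1.comp hcont.continuousOn hline).inner continuousOn_const) (C := 0)
    (fun k hk s hs t ht => by
      have h1 := hcell k hk _ ht.1 _ hs.1
      have h2 : (AffineMap.lineMap x y s : E d) - AffineMap.lineMap x y t = (s - t) • (y - x) := by
        simp only [AffineMap.lineMap_apply, vsub_eq_sub, vadd_eq_add]; module
      rw [h2, real_inner_smul_right, mul_eq_zero] at h1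
      rw [zero_mul, norm_le_zero_iff, ← inner_sub_left]
      rcases h1 with h1 | h1
      · rw [sub_eq_zero.mp h1]; simp
      · exact h1)
  rw [norm_le_zero_iff] at this
  simpa [inner_sub_left] using this

/-- An infinitesimal isometry of an open set is a rigid motion. -/
theorem exists_rigidMotion_of_inner_sub_eq_zero (hΩo : IsOpen Ω) (hΩn : Ω.Nonempty)
    {u : E d → E d} (h : ∀ x ∈ Ω, ∀ y ∈ Ω, inner ℝ (u y - u x) (y - x) = 0) :
    ∃ r ∈ rigidMotions d, ∀ x ∈ Ω, u x = r x := by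
  obtain ⟨x₀, hx₀⟩ := hΩn
  obtain ⟨δ, hδ, hball⟩ := Metric.isOpen_iff.mp hΩo x₀ hx₀
  set t := δ / 2 with ht
  have ht0 : 0 < t := by positivity
  let e : Fin d → E d := fun j => EuclideanSpace.single j t
  have he : ∀ j, x₀ + e j ∈ Ω := fun j => hball (by
    simp only [e, Metric.mem_ball, dist_self_add_left, PiLp.norm_single,
      Real.norm_of_nonneg ht0.le]
    linarith)
  let w : E d → E d := fun x => u x - u x₀
  -- Polarisation of the hypothesis. Taking `y = x₀ + t e_j` then expresses each component of `w x`
  -- linearly in `x - x₀`, which dictates the matrix `B`.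
  have hw : ∀ x ∈ Ω, ∀ y ∈ Ω, inner ℝ (w x) (y - x₀) = - inner ℝ (w y) (x - x₀) := by
    intro x hx y hy
    have h1 := h x₀ hx₀ x hx
    have h2 := h x₀ hx₀ y hy
    have h3 := h x hx y hy
    have e1 : u y - u x = w y - w x := by simp [w]
    have e2 : y - x = (y - x₀) - (x - x₀) := by abel
    change inner ℝ (w x) (x - x₀) = 0 at h1
    change inner ℝ (w y) (y - x₀) = 0 at h2
    rw [e1, e2] at h3
    generalize x - x₀ = p at *
    generalize y - x₀ = q at *
    rw [inner_sub_left, inner_sub_right, inner_sub_right] at h3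
    linarith
  let B : Matrix (Fin d) (Fin d) ℝ := Matrix.of fun j i => - (w (x₀ + e j) i) / t
  have hB : ∀ x ∈ Ω, ∀ j, w x j = ∑ i, B j i * (x i - x₀ i) := by
    intro x hx j
    have h1 := hw x hx _ (he j)
    rw [add_sub_cancel_left, EuclideanSpace.inner_single_right, PiLp.inner_apply] at h1
    simp only [conj_trivial, real_inner_eq_mul, PiLp.sub_apply] at h1
    have h2 : w x j = - (∑ i, w (x₀ + e j) i * (x i - x₀ i)) / t := by
      rw [← h1]; field_simp
    rw [h2, neg_div, Finset.sum_div, ← Finset.sum_neg_distrib]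
    refine Finset.sum_congr rfl fun i _ => ?_
    simp only [B, Matrix.of_apply]
    ring
  have hskew : ∀ i j, B j i = - B i j := by
    intro i j
    have h1 := hB _ (he i) j
    have h2 : ∑ k, B j k * ((x₀ + e i) k - x₀ k) = B j i * t := by
      simp [e]
    rw [h2] at h1
    have h3 : B i j = - (w (x₀ + e i) j) / t := rfl
    rw [h3, h1]
    field_simp
  refine ⟨fun x => WithLp.toLp 2 fun i => (u x₀ i - B.mulVec (fun j => x₀ j) i) +
    B.mulVec (fun j => x j) i, ⟨WithLp.toLp 2 fun i => u x₀ i - B.mulVec (fun j => x₀ j) i, B, ?_,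
    fun x i => rfl⟩, fun x hx => ?_⟩
  · ext i j
    rw [Matrix.transpose_apply, Matrix.neg_apply, hskew]
  · ext i
    have h1 := hB x hx i
    have h2 : u x i = u x₀ i + w x i := by simp [w]
    rw [h2, h1]
    simp only [Matrix.mulVec, dotProduct, mul_sub, Finset.sum_sub_distrib]
    ring

/-- A discrete Korn inequality: on `V_h` the strain determines the displacement. -/
theorem eq_zero_of_strain_eq_zero (hT : (⋃ k ∈ T, convexHull ℝ (k : Set (E d))) = closure Ω)
    (hΩo : IsOpen Ω) (hΩc : Convex ℝ Ω) (hΩb : Bornology.IsBounded Ω) (hΩn : Ω.Nonempty)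
    {u : E d → E d} (hu : u ∈ Vh Ω T)
    (h : ∀ᵐ x ∂(volume.restrict Ω), strainL d (fderiv ℝ u x) = 0) : u = 0 := by
  have hfe := Xh_subset_feSpace hu.1
  obtain ⟨r, hr, hur⟩ := exists_rigidMotion_of_inner_sub_eq_zero hΩo hΩn fun x hx y hy =>
    inner_sub_eq_zero_of_strain hT hΩo hΩc hΩn hfe h (subset_closure hx) (subset_closure hy)
  refine eq_zero_of_mem_feSpace hΩo hfe ?_
  -- On `Ω` the field equals the rigid motion `r`, so orthogonality to `r` says `∫ |u|² = 0`.
  have h1 : 0 ≤ᵐ[volume.restrict Ω] fun x => (inner ℝ (u x) (r x) : ℝ) := by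
    filter_upwards [ae_restrict_mem hΩo.measurableSet] with x hx
    rw [hur x hx]
    exact real_inner_self_nonneg
  have h2 := (integral_eq_zero_iff_of_nonneg_ae h1
    (integrable_inner_rigidMotion hΩb hfe hr)).mp (hu.2 r hr)
  filter_upwards [h2, ae_restrict_mem hΩo.measurableSet] with x hx hxΩ
  rw [← hur x hxΩ] at hx
  exact inner_self_eq_zero.mp hx

end Poro

/-! ### A divergence inequality on convex domains by dilation. -/

namespace Poro

variable {d : ℕ} {Ω : Set (E d)} {T : Finset (Finset (E d))}

/-- The frontier of a convex set is null. Integrals become whole-space integrals, where translation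
and scaling are available. -/
theorem integral_domain_eq_integral_of_mem_feSpace (hΩo : IsOpen Ω) (hΩc : Convex ℝ Ω)
    {w : E d → ℝ} (hw : ∀ x ∉ closure Ω, w x = 0) :
    ∫ x in Ω, w x = ∫ x, w x := by
  have h1 : ∫ x in Ω, w x = ∫ x in closure Ω, w x := by
    refine setIntegral_congr_set (ae_eq_set.mpr ⟨?_, ?_⟩)
    · rw [sdiff_eq_empty.mpr subset_closure, measure_empty]
    · have := hΩc.addHaar_frontier volume
      rwa [hΩo.frontier_eq] at this
  rw [h1]
  exact setIntegral_eq_integral_of_forall_compl_eq_zero hw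

/-- Contracting a star-shaped domain towards its centre. -/
theorem integral_dilation_le (hΩo : IsOpen Ω) (hΩc : Convex ℝ Ω) (hΩb : Bornology.IsBounded Ω)
    {w : E d → ℝ} (hw : w ∈ feSpace Ω T ℝ) (hw0 : ∀ x, 0 ≤ w x) (x₀ : E d) {s : ℝ}
    (hs : 0 < s) :
    ∫ x in Ω, w (AffineMap.lineMap x₀ x s) ≤ (s ^ d)⁻¹ * ∫ x in Ω, w x := by
  have e1 : ∫ x, w (AffineMap.lineMap x₀ x s) = (s ^ d)⁻¹ * ∫ x in Ω, w x := by
    rw [integral_domain_eq_integral_of_mem_feSpace hΩo hΩc hw.2.1]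
    have h1 : (fun x => w (AffineMap.lineMap x₀ x s)) =
        fun x => (fun y => w (s • y + x₀)) (x - x₀) := by
      funext x
      simp [AffineMap.lineMap_apply]
    rw [h1, integral_sub_right_eq_self (fun y => w (s • y + x₀)) x₀,
      Measure.integral_comp_smul volume (fun y => w (y + x₀)) s,
      integral_add_right_eq_self w x₀, finrank_euclideanSpace_fin, smul_eq_mul,
      abs_of_pos (by positivity)]
  rw [← e1]
  -- The scaling formula is exact on the whole space; restricting to `Ω` only discards nonnegative
  -- contributions.
  refine setIntegral_le_integral ?_ (Filter.Eventually.of_forall fun x => hw0 _)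
  have hint : Integrable w := by
    have : w = (closure Ω).indicator w := by
      funext x
      by_cases hx : x ∈ closure Ω
      · rw [indicator_of_mem hx]
      · rw [indicator_of_notMem hx, hw.2.1 x hx]
    rw [this, integrable_indicator_iff isClosed_closure.measurableSet]
    exact hw.1.integrableOn_compact hΩb.isCompact_closure
  have h1 : (fun x => w (AffineMap.lineMap x₀ x s)) =
      fun x => (fun y => w (s • y + x₀)) (x - x₀) := by
    funext x
    simp [AffineMap.lineMap_apply]
  rw [h1]
  exact ((hint.comp_add_right x₀).comp_smul hs.ne').comp_sub_right x₀

open Filter Topology in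
/-- The divergence theorem on a convex domain, as an inequality: the flux of `w (x - x₀)` through
the boundary is nonnegative for `w ≥ 0`. -/
theorem integral_star_nonneg (hT : (⋃ k ∈ T, convexHull ℝ (k : Set (E d))) = closure Ω)
    (hΩo : IsOpen Ω) (hΩc : Convex ℝ Ω) (hΩb : Bornology.IsBounded Ω)
    {w : E d → ℝ} (hw : w ∈ feSpace Ω T ℝ) (hw0 : ∀ x, 0 ≤ w x) {x₀ : E d} (hx₀ : x₀ ∈ Ω) :
    0 ≤ d * (∫ x in Ω, w x) + ∫ x in Ω, fderiv ℝ w x (x - x₀) := by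
  have hfin : IsFiniteMeasure (volume.restrict Ω) :=
    isFiniteMeasure_restrict.mpr hΩb.measure_lt_top.ne
  obtain ⟨C, hC0, hC⟩ := exists_lipschitz_of_mem_feSpace hT hΩc hw
  obtain ⟨R, hR⟩ := (hΩb.isCompact_closure).exists_bound_of_continuousOn
    (f := fun x => x - x₀) (by fun_prop)
  let s : ℕ → ℝ := fun n => 1 - 1 / ((n : ℝ) + 2)
  have hs0 : ∀ n, 0 < s n := fun n => by
    have : 1 / ((n : ℝ) + 2) < 1 := by
      rw [div_lt_one (by positivity)]
      linarith [n.cast_nonneg (α := ℝ)]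
    simp only [s]; linarith
  have hs1 : ∀ n, s n < 1 := fun n => by
    have : 0 < 1 / ((n : ℝ) + 2) := by positivity
    simp only [s]; linarith
  have hslim : Tendsto s atTop (𝓝[≠] 1) := by
    refine tendsto_nhdsWithin_iff.mpr ⟨?_, Eventually.of_forall fun n => (hs1 n).ne⟩
    have h1 : Tendsto (fun n : ℕ => 1 / ((n : ℝ) + 2)) atTop (𝓝 0) := by
      have := (tendsto_one_div_add_atTop_nhds_zero_nat (𝕜 := ℝ)).comp (tendsto_add_atTop_nat 1)
      refine this.congr fun n => ?_
      simp only [Function.comp]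
      push_cast
      ring
    simpa [s] using (tendsto_const_nhds (x := (1 : ℝ))).sub h1
  have hline : ∀ n, ∀ x ∈ Ω, (AffineMap.lineMap x₀ x (s n) : E d) ∈ Ω := fun n x hx =>
    hΩc.lineMap_mem hx₀ hx ⟨(hs0 n).le, (hs1 n).le⟩
  have hdiff : ∀ n, ∀ x, x - (AffineMap.lineMap x₀ x (s n) : E d) = (1 - s n) • (x - x₀) :=
    fun n x => by
      simp only [AffineMap.lineMap_apply, vsub_eq_sub, vadd_eq_add]; module
  have hcont : ∀ n, Continuous fun x : E d => (AffineMap.lineMap x₀ x (s n) : E d) := fun n => by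
    simp only [AffineMap.lineMap_apply, vsub_eq_sub, vadd_eq_add]
    fun_prop
  -- Difference quotients of `w` along the rays from `x₀`, at dilation factors increasing to `1`.
  -- They are dominated by the Lipschitz constant and converge to `∇w·(x - x₀)`.
  let G : ℕ → E d → ℝ := fun n x =>
    slope (fun r : ℝ => w (AffineMap.lineMap x₀ x r)) 1 (s n)
  have hG : ∀ n x, G n x = (w x - w (AffineMap.lineMap x₀ x (s n))) / (1 - s n) := fun n x => by
    simp only [G, slope_def_field, AffineMap.lineMap_apply_one]
    rw [← neg_sub, ← neg_sub (1 : ℝ), neg_div_neg_eq]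
  have hcontw : ∀ n, ContinuousOn (fun x => w (AffineMap.lineMap x₀ x (s n))) Ω := fun n =>
    (hw.1.mono subset_closure).comp (hcont n).continuousOn (hline n)
  have hint1 : ∀ n, Integrable (fun x => w (AffineMap.lineMap x₀ x (s n))) (volume.restrict Ω) := by
    intro n
    obtain ⟨C, hC⟩ := exists_bound_of_mem_feSpace hΩb hw
    exact Integrable.of_bound ((hcontw n).aestronglyMeasurable hΩo.measurableSet) C
      ((ae_restrict_mem hΩo.measurableSet).mono fun x hx => hC _ (subset_closure (hline n x hx)))
  have hint0 : Integrable w (volume.restrict Ω) :=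
    (hw.1.integrableOn_compact hΩb.isCompact_closure).mono_set subset_closure
  have hlim : Tendsto (fun n => ∫ x in Ω, G n x) atTop (𝓝 (∫ x in Ω, fderiv ℝ w x (x - x₀))) := by
    refine tendsto_integral_of_dominated_convergence (fun _ => C * R) (fun n => ?_)
      (integrable_const _) (fun n => ?_) ?_
    · exact ((hint0.sub (hint1 n)).div_const _).aestronglyMeasurable.congr
        (Eventually.of_forall fun x => (hG n x).symm)
    · filter_upwards [ae_restrict_mem hΩo.measurableSet] with x hx
      have h0 : 0 < 1 - s n := sub_pos.mpr (hs1 n)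
      rw [hG, norm_div, Real.norm_of_nonneg h0.le, div_le_iff₀ h0]
      refine (hC _ (subset_closure (hline n x hx)) x (subset_closure hx)).trans ?_
      rw [hdiff, norm_smul, Real.norm_of_nonneg h0.le]
      have := hR x (subset_closure hx)
      calc C * ((1 - s n) * ‖x - x₀‖) ≤ C * ((1 - s n) * R) := by gcongr
        _ = C * R * (1 - s n) := by ring
    · filter_upwards [ae_mem_openCells hT hΩo] with x hx
      have hw' := (differentiableAt_of_mem_feSpace hw hx).hasFDerivAt
      have h1 : HasDerivAt (fun r : ℝ => w (AffineMap.lineMap x₀ x r))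
          (fderiv ℝ w x (x - x₀)) 1 := by
        have h2 : HasDerivAt (fun r : ℝ => (AffineMap.lineMap x₀ x r : E d)) (x - x₀) 1 :=
          AffineMap.hasDerivAt_lineMap
        have h3 : HasFDerivAt w (fderiv ℝ w x) (AffineMap.lineMap x₀ x (1 : ℝ)) := by
          rwa [AffineMap.lineMap_apply_one]
        exact h3.comp_hasDerivAt 1 h2
      exact (hasDerivAt_iff_tendsto_slope.mp h1).comp hslim
  have hlim2 : Tendsto (fun n => slope (fun r : ℝ => (r ^ d)⁻¹) 1 (s n) * ∫ x in Ω, w x) atTop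
      (𝓝 (-d * ∫ x in Ω, w x)) := by
    refine Tendsto.mul_const _ ?_
    have h1 : HasDerivAt (fun r : ℝ => (r ^ d)⁻¹) (-d) 1 := by
      have := (hasDerivAt_pow d (1 : ℝ)).fun_inv (by simp)
      simpa using this
    exact (hasDerivAt_iff_tendsto_slope.mp h1).comp hslim
  -- Both sides of the dilation inequality agree at factor `1`, so it passes to their difference
  -- quotients; `s ↦ s^{-d}` has derivative `-d` there.
  have hle : -d * (∫ x in Ω, w x) ≤ ∫ x in Ω, fderiv ℝ w x (x - x₀) := by
    refine le_of_tendsto_of_tendsto' hlim2 hlim fun n => ?_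
    have h0 : 0 < 1 - s n := sub_pos.mpr (hs1 n)
    simp only [hG]
    rw [integral_div, integral_sub hint0 (hint1 n), slope_def_field, ← neg_sub (1 : ℝ),
      div_neg, le_div_iff₀ h0]
    have h2 := integral_dilation_le hΩo hΩc hΩb hw hw0 x₀ (hs0 n)
    have h3 : -(((s n ^ d)⁻¹ - (1 ^ d)⁻¹) / (1 - s n)) * (∫ x in Ω, w x) * (1 - s n) =
        (∫ x in Ω, w x) - (s n ^ d)⁻¹ * ∫ x in Ω, w x := by
      field_simp
      simp only [one_pow]
      ring
    rw [h3]
    linarith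
  linarith

end Poro

namespace Poro

variable {d : ℕ} {Ω : Set (E d)} {T : Finset (Finset (E d))}

/-! ### The divergence is onto up to the mass pairing -/

theorem totalDegree_affine_le (a : ℝ) (c : Fin d → ℝ) :
    (MvPolynomial.C a + ∑ j, MvPolynomial.C (c j) * MvPolynomial.X j).totalDegree ≤ 1 := by
  refine (MvPolynomial.totalDegree_add _ _).trans (max_le (by simp) ?_)
  refine MvPolynomial.totalDegree_finsetSum_le fun j _ => ?_
  refine (MvPolynomial.totalDegree_mul _ _).trans ?_
  simp

/-- Rigid motions restricted to `closure Ω` belong to `X_h`. -/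
theorem indicator_rigidMotion_mem_Xh
    (hT : (⋃ k ∈ T, convexHull ℝ (k : Set (E d))) = closure Ω) {r : E d → E d}
    (hr : r ∈ rigidMotions d) : (closure Ω).indicator r ∈ Xh Ω T := by
  intro i
  have hcont := continuous_of_mem_rigidMotions hr
  obtain ⟨a, B, -, h⟩ := hr
  have hon : ∀ x ∈ closure Ω, (closure Ω).indicator r x i = r x i := fun x hx => by
    rw [indicator_of_mem hx]
  refine ⟨?_, fun x hx => by simp [hx], fun k hk => ?_⟩
  · have : ContinuousOn (fun x => r x i) (closure Ω) := by fun_prop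
    exact this.congr hon
  · refine ⟨_, (totalDegree_affine_le (a i) (B i)).trans one_le_two, fun x hx => ?_⟩
    have hx' : x ∈ closure Ω := by
      rw [← hT]; exact mem_biUnion (x := k) hk hx
    refine (hon x hx').trans ?_
    rw [h]
    simp [Matrix.mulVec, dotProduct]

/-- A skew matrix has trace zero, so correcting a test field by a rigid motion to reach `V_h` leaves
its divergence unchanged. -/
theorem divg_indicator_rigidMotion (hΩo : IsOpen Ω) {r : E d → E d} (hr : r ∈ rigidMotions d)
    {x : E d} (hx : x ∈ Ω) : divg ((closure Ω).indicator r) x = 0 := by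
  obtain ⟨a, B, hB, h⟩ := hr
  have hev : (closure Ω).indicator r =ᶠ[nhds x] r := by
    filter_upwards [hΩo.mem_nhds hx] with y hy using indicator_of_mem (subset_closure hy) r
  have hr' : r = fun x => a + Matrix.toEuclideanCLM (n := Fin d) (𝕜 := ℝ) B x := by
    funext x
    ext i
    rw [h]
    rfl
  have hder : fderiv ℝ ((closure Ω).indicator r) x =
      Matrix.toEuclideanCLM (n := Fin d) (𝕜 := ℝ) B := by
    rw [hev.fderiv_eq, hr']
    exact ((Matrix.toEuclideanCLM (n := Fin d) (𝕜 := ℝ) B).hasFDerivAt.const_add a).fderiv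
  have hdiag : ∀ i, B i i = 0 := fun i => by
    have := congrFun (congrFun hB i) i
    rw [Matrix.transpose_apply, Matrix.neg_apply] at this
    linarith
  rw [divg, Matrix.trace]
  refine Finset.sum_eq_zero fun i _ => ?_
  rw [Matrix.diag_apply, jac, Matrix.of_apply, hder, ← hdiag i]
  change B.mulVec (EuclideanSpace.single i (1 : ℝ)) i = _
  simp

/-- Every element of `X_h` is the sum of an element of `V_h` and a rigid motion. -/
theorem exists_rigidMotion_sub_mem_Vh
    (hT : (⋃ k ∈ T, convexHull ℝ (k : Set (E d))) = closure Ω) (hΩo : IsOpen Ω)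
    (hΩb : Bornology.IsBounded Ω) {v : E d → E d} (hv : v ∈ Xh Ω T) :
    ∃ r ∈ rigidMotions d, v - (closure Ω).indicator r ∈ Vh Ω T := by
  have hfin : IsFiniteMeasure (volume.restrict Ω) :=
    isFiniteMeasure_restrict.mpr hΩb.measure_lt_top.ne
  obtain ⟨D, hD⟩ := exists_value_map (F := E d) (T := T) hΩb volume hΩo.measurableSet subset_closure
  let R : Submodule ℝ (E d → E d) :=
    { carrier := {w | ∃ r ∈ rigidMotions d, w = (closure Ω).indicator r}
      add_mem' := by
        rintro _ _ ⟨r, ⟨a, B, hB, hr⟩, rfl⟩ ⟨r', ⟨a', B', hB', hr'⟩, rfl⟩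
        refine ⟨r + r', ⟨a + a', B + B', by rw [Matrix.transpose_add, hB, hB', neg_add],
          fun x i => ?_⟩, (indicator_add _ _ _).symm⟩
        simp only [Pi.add_apply, PiLp.add_apply, hr, hr', Matrix.add_mulVec]
        ring
      zero_mem' := ⟨0, ⟨0, 0, by simp, fun x i => by simp⟩, by simp⟩
      smul_mem' := by
        rintro c _ ⟨r, ⟨a, B, hB, hr⟩, rfl⟩
        refine ⟨c • r, ⟨c • a, c • B, by rw [Matrix.transpose_smul, hB, smul_neg],
          fun x i => ?_⟩, (indicator_const_smul _ c r).symm⟩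
        simp only [Pi.smul_apply, PiLp.smul_apply, hr, Matrix.smul_mulVec, smul_eq_mul]
        ring }
  have hRX : R ≤ XhSpace Ω T := by
    rintro _ ⟨r, hr, rfl⟩
    exact indicator_rigidMotion_mem_Xh hT hr
  have := finiteDimensional_XhSpace hT
  have : FiniteDimensional ℝ R := Submodule.finiteDimensional_of_le hRX
  have hRfe : R ≤ feSpace Ω T (E d) := fun w hw => Xh_subset_feSpace (hRX hw)
  let ι : R →ₗ[ℝ] Lp (E d) 2 (volume.restrict Ω) := D ∘ₗ Submodule.inclusion hRfe
  have hι : ∀ w, ι w =ᵐ[volume.restrict Ω] (w : E d → E d) := fun w =>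
    hD (Submodule.inclusion hRfe w)
  let v' : feSpace Ω T (E d) := ⟨v, Xh_subset_feSpace hv⟩
  -- `w` is the `L²` projection of `v` onto the truncated rigid motions.
  obtain ⟨w, hw, -⟩ := existsUnique_of_posDef ((innerₗ _).compl₁₂ ι ι)
    (fun w hw => by
      have h0 : ι w = 0 := inner_self_eq_zero.mp hw
      have h1 : ∀ᵐ x ∂(volume.restrict Ω), (w : E d → E d) x = 0 := by
        filter_upwards [hι w, (h0 ▸ Lp.coeFn_zero (E d) 2 (volume.restrict Ω) :
          ι w =ᵐ[volume.restrict Ω] 0)] with x h1 h2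
        rw [← h1, h2]; rfl
      exact Subtype.ext (eq_zero_of_mem_feSpace hΩo (hRfe w.2) h1))
    ((innerₗ _ (D v')) ∘ₗ ι)
  obtain ⟨r, hr, hwr⟩ := w.2
  refine ⟨r, hr, ⟨(XhSpace Ω T).sub_mem hv (indicator_rigidMotion_mem_Xh hT hr), fun r' hr' => ?_⟩⟩
  let w' : R := ⟨(closure Ω).indicator r', r', hr', rfl⟩
  have h1 := hw w'
  simp only [LinearMap.compl₁₂_apply, LinearMap.comp_apply, innerₗ_apply_apply] at h1
  have h2 : inner ℝ (D v' - ι w) (ι w') = 0 := by rw [inner_sub_left, h1, sub_self]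
  have h3 : D v' - ι w =ᵐ[volume.restrict Ω] v - (closure Ω).indicator r := by
    filter_upwards [Lp.coeFn_sub (D v') (ι w), hD v', hι w] with x e1 e2 e3
    rw [e1, Pi.sub_apply, Pi.sub_apply, e2, e3, hwr]
  rw [L2_inner_eq_integral h3 (hι w')] at h2
  rw [← h2]
  refine setIntegral_congr_fun hΩo.measurableSet fun x hx => ?_
  simp only [w', indicator_of_mem (subset_closure hx : x ∈ closure Ω)]

/-- The product of a continuous piecewise linear function with `x - x₀` belongs to `X_h`. -/
theorem smul_sub_mem_Xh {q : E d → ℝ} (hq : q ∈ Mh Ω T) (x₀ : E d) :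
    (fun x => q x • (x - x₀)) ∈ Xh Ω T := by
  obtain ⟨h1, h2, h3⟩ := hq
  intro i
  refine ⟨?_, fun x hx => by simp [h2 x hx], fun k hk => ?_⟩
  · have : ContinuousOn (fun x => q x * (x i - x₀ i)) (closure Ω) :=
      h1.mul (by fun_prop)
    exact this
  · obtain ⟨p, hp, hqp⟩ := h3 k hk
    refine ⟨p * (MvPolynomial.X i - MvPolynomial.C (x₀ i)),
      (MvPolynomial.totalDegree_mul _ _).trans (add_le_add hp
        ((MvPolynomial.totalDegree_sub_C_le _ _).trans (MvPolynomial.totalDegree_X i).le)),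
      fun x hx => ?_⟩
    have := hqp x hx
    simp only [PiLp.smul_apply, PiLp.sub_apply, smul_eq_mul, this, map_mul, map_sub,
      MvPolynomial.eval_X, MvPolynomial.eval_C]

theorem divg_smul_sub {q : E d → ℝ} {x : E d} (hq : DifferentiableAt ℝ q x) (x₀ : E d) :
    divg (fun x => q x • (x - x₀)) x = d * q x + fderiv ℝ q x (x - x₀) := by
  have h : HasFDerivAt (fun x => q x • (x - x₀))
      (q x • ContinuousLinearMap.id ℝ (E d) + (fderiv ℝ q x).smulRight (x - x₀)) x :=
    hq.hasFDerivAt.smul ((hasFDerivAt_id x).sub_const x₀)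
  have hz : x - x₀ = ∑ j, (x - x₀) j • EuclideanSpace.single j (1 : ℝ) := by
    ext i
    simp [Finset.sum_apply, Pi.single_apply]
  rw [divg, Matrix.trace]
  simp only [Matrix.diag_apply, jac, Matrix.of_apply, h.fderiv]
  conv_rhs => rw [hz, map_sum]
  simp only [add_apply, smul_apply,
    ContinuousLinearMap.id_apply, ContinuousLinearMap.smulRight_apply, PiLp.add_apply,
    PiLp.smul_apply, smul_eq_mul, map_smul, Finset.sum_add_distrib]
  congr 1
  · simp
  · exact Finset.sum_congr rfl fun i _ => by ring

/-- The discrete inf-sup condition: a pressure that is orthogonal to all divergences vanishes. -/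
theorem eq_zero_of_forall_integral_divg_eq_zero (hd : 0 < d)
    (hT : (⋃ k ∈ T, convexHull ℝ (k : Set (E d))) = closure Ω)
    (hΩo : IsOpen Ω) (hΩc : Convex ℝ Ω) (hΩb : Bornology.IsBounded Ω) (hΩn : Ω.Nonempty)
    {q : E d → ℝ} (hq : q ∈ Mh Ω T) (h : ∀ v ∈ Vh Ω T, ∫ x in Ω, q x * divg v x = 0) : q = 0 := by
  have hfe : q ∈ feSpace Ω T ℝ := lagrange_subset_feSpace hq
  obtain ⟨x₀, hx₀⟩ := hΩn
  have hv := smul_sub_mem_Xh hq x₀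
  have hvfe := Xh_subset_feSpace hv
  obtain ⟨r, hr, hvr⟩ := exists_rigidMotion_sub_mem_Vh hT hΩo hΩb hv
  have hcells := openCells_subset hT hΩo hΩc ⟨x₀, hx₀⟩
  -- The test field is `q (x - x₀)` minus its rigid part.
  have h1 : ∫ x in Ω, q x * (d * q x + fderiv ℝ q x (x - x₀)) = 0 := by
    rw [← h _ hvr]
    refine integral_congr_ae ?_
    filter_upwards [ae_mem_openCells hT hΩo] with x hx
    have hrfe := Xh_subset_feSpace (indicator_rigidMotion_mem_Xh (T := T) hT hr)
    have e1 : divL d (fderiv ℝ ((fun x => q x • (x - x₀)) - (closure Ω).indicator r) x) =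
        divg (fun x => q x • (x - x₀)) x - divg ((closure Ω).indicator r) x := by
      rw [fderiv_sub (differentiableAt_of_mem_feSpace hvfe hx)
        (differentiableAt_of_mem_feSpace hrfe hx), map_sub, divL_fderiv, divL_fderiv]
    rw [← divL_fderiv, e1, divg_indicator_rigidMotion hΩo hr (hcells hx), sub_zero,
      divg_smul_sub (differentiableAt_of_mem_feSpace hfe hx)]
  have hw : (fun x => q x ^ 2) ∈ feSpace Ω T ℝ := by
    refine ⟨hfe.1.pow 2, fun x hx => by simp [hfe.2.1 x hx], fun k hk => ?_⟩
    obtain ⟨P, hP, hqP⟩ := hfe.2.2 k hk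
    exact ⟨fun x => P x ^ 2, hP.pow 2, fun x hx => by simp only [hqP hx]⟩
  have h2 := integral_star_nonneg hT hΩo hΩc hΩb hw (fun x => sq_nonneg (q x)) hx₀
  have hint : Integrable (fun x => q x ^ 2) (volume.restrict Ω) :=
    (hw.1.integrableOn_compact hΩb.isCompact_closure).mono_set subset_closure
  have h3 : ∫ x in Ω, fderiv ℝ (fun x => q x ^ 2) x (x - x₀) =
      ∫ x in Ω, (2 * (q x * (d * q x + fderiv ℝ q x (x - x₀))) - 2 * d * q x ^ 2) := by
    refine integral_congr_ae ?_
    filter_upwards [ae_mem_openCells hT hΩo] with x hx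
    have hd := (differentiableAt_of_mem_feSpace hfe hx).hasFDerivAt.pow 2
    rw [hd.fderiv]
    simp
    ring
  have hint2 : Integrable (fun x => q x * (d * q x + fderiv ℝ q x (x - x₀)))
      (volume.restrict Ω) := by
    have hfin : IsFiniteMeasure (volume.restrict Ω) :=
      isFiniteMeasure_restrict.mpr hΩb.measure_lt_top.ne
    refine ((memLp_of_mem_feSpace hΩb hfe volume hΩo.measurableSet subset_closure 2).integrable_mul
      ((memLp_fderiv_of_mem_feSpace hT hΩo hΩb hvfe 2).continuousLinearMap_comp (divL d))).congr ?_
    filter_upwards [ae_mem_openCells hT hΩo] with x hx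
    rw [Pi.mul_apply, divL_fderiv, divg_smul_sub (differentiableAt_of_mem_feSpace hfe hx)]
  rw [h3, integral_sub (hint2.const_mul 2) (hint.const_mul _), integral_const_mul, h1,
    integral_const_mul] at h2
  -- The divergence inequality for `w = q²` now reads `0 ≤ d ∫ q² - 2d ∫ q²`.
  have h4 : ∫ x in Ω, q x ^ 2 = 0 := by
    have h5 : 0 ≤ ∫ x in Ω, q x ^ 2 := integral_nonneg fun x => sq_nonneg _
    have hd' : (0 : ℝ) < d := by exact_mod_cast hd
    nlinarith
  have h5 := (integral_eq_zero_iff_of_nonneg (fun x => sq_nonneg (q x)) hint).mp h4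
  refine eq_zero_of_mem_feSpace hΩo hfe ?_
  filter_upwards [h5] with x hx
  exact pow_eq_zero_iff two_ne_zero |>.mp hx

end Poro

/-! ### Solvability of one time step. -/

namespace Poro

variable {d : ℕ} {Ω : Set (E d)} {T : Finset (Finset (E d))}

/-- One time step of the scheme has exactly one solution. -/
theorem existsUnique_isStepSolution (hd : 0 < d) (hΩo : IsOpen Ω) (hΩc : Convex ℝ Ω)
    (hΩb : Bornology.IsBounded Ω) (hΩn : Ω.Nonempty) {m : Material d} (hm : m.IsAdmissible Ω)
    (hT : (⋃ k ∈ T, convexHull ℝ (k : Set (E d))) = closure Ω) {s : Sources d} {t₁ : ℝ}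
    (hs : s.IsAdmissible Ω t₁) (θ : Fin 2) {dt t : ℝ} (hdt : 0 < dt) (ht : t ∈ Ioc 0 t₁)
    {ηold : E d → ℝ} (hη : ηold ∈ Wh Ω T) :
    ∃! w : (E d → E d) × (E d → ℝ) × (E d → ℝ),
      IsStepSolution m s Ω T θ dt t ηold w.1 w.2.1 w.2.2 := by
  have hfin : IsFiniteMeasure (volume.restrict Ω) :=
    isFiniteMeasure_restrict.mpr hΩb.measure_lt_top.ne
  -- Finite surface measure puts the boundary values of discrete functions in `L²(∂Ω)`, so the
  -- boundary terms are linear functionals.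
  have hfinS : IsFiniteMeasure
      ((Measure.euclideanHausdorffMeasure (d - 1) : Measure (E d)).restrict (frontier Ω)) :=
    isFiniteMeasure_surf hd hΩo hΩc hΩn hT
  let V := VhSpace T hΩb
  let M := lagrangeSpace Ω T 1
  have hVfin : FiniteDimensional ℝ V := finiteDimensional_VhSpace hT hΩb
  have hMfin : FiniteDimensional ℝ M := finiteDimensional_lagrangeSpace hT 1
  have hVle : V ≤ feSpace Ω T (E d) := fun v hv => Xh_subset_feSpace hv.1
  have hMle : M ≤ feSpace Ω T ℝ := fun q hq => lagrange_subset_feSpace hq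
  let ιV := Submodule.inclusion hVle
  let ιM := Submodule.inclusion hMle
  obtain ⟨S, hS⟩ := exists_derivative_map (F := E d) hT hΩo hΩb (strainL d)
  obtain ⟨D, hD⟩ := exists_derivative_map (F := E d) hT hΩo hΩb (divL d)
  obtain ⟨W, hW⟩ := exists_value_map (F := E d) (T := T) hΩb volume hΩo.measurableSet subset_closure
  obtain ⟨W', hW'⟩ := exists_value_map (F := E d) (T := T) hΩb
    (Measure.euclideanHausdorffMeasure (d - 1)) isClosed_frontier.measurableSet
    (frontier_subset_closure : frontier Ω ⊆ closure Ω)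
  obtain ⟨G, hG⟩ := exists_derivative_map (F := ℝ) hT hΩo hΩb (gradL d)
  obtain ⟨Q, hQ⟩ := exists_value_map (F := ℝ) (T := T) hΩb volume hΩo.measurableSet subset_closure
  obtain ⟨Q', hQ'⟩ := exists_value_map (F := ℝ) (T := T) hΩb
    (Measure.euclideanHausdorffMeasure (d - 1)) isClosed_frontier.measurableSet
    (frontier_subset_closure : frontier Ω ⊆ closure Ω)
  obtain ⟨KG, hKG⟩ := exists_linearMap_toLp (ν := volume.restrict Ω)
    (fun (q : feSpace Ω T ℝ) x =>
      (WithLp.toLp 2 ((m.K x).mulVec (grad (q : E d → ℝ) x)) : E d))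
    (fun q => hm.memLp_K_mulVec
      ((memLp_fderiv_of_mem_feSpace hT hΩo hΩb q.2 2).continuousLinearMap_comp (gradL d)))
    (fun p q => (ae_mem_openCells hT hΩo).mono fun x hx => by
      have h1 : grad ((p + q : feSpace Ω T ℝ) : E d → ℝ) x =
          grad (p : E d → ℝ) x + grad (q : E d → ℝ) x := by
        funext j
        simp only [grad, Submodule.coe_add, Pi.add_apply, fderiv_add_of_mem_feSpace p.2 q.2 hx,
          add_apply]
      rw [h1, Matrix.mulVec_add]; rfl)
    (fun c q => (ae_mem_openCells hT hΩo).mono fun x hx => by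
      have h1 : grad ((c • q : feSpace Ω T ℝ) : E d → ℝ) x = c • grad (q : E d → ℝ) x := by
        funext j
        simp only [grad, Submodule.coe_smul, Pi.smul_apply, fderiv_smul_of_mem_feSpace q.2 c hx,
          smul_apply]
      rw [h1, Matrix.mulVec_smul]; rfl)
  have hKgmem : MemLp (fun x => (WithLp.toLp 2 ((m.K x).mulVec fun i => m.g x i) : E d)) 2
      (volume.restrict Ω) := hm.memLp_K_mulVec hm.g_memLp
  obtain ⟨A, γ, L, hγ, hA, hA1, hA2⟩ := exists_stress_operator hd hΩo hΩn hm
  let b : V →ₗ[ℝ] M →ₗ[ℝ] ℝ := (innerₗ _).compl₁₂ (D ∘ₗ ιV) (Q ∘ₗ ιM)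
  let mass : M →ₗ[ℝ] M →ₗ[ℝ] ℝ := (innerₗ _).compl₁₂ (Q ∘ₗ ιM) (Q ∘ₗ ιM)
  let stiff : M →ₗ[ℝ] M →ₗ[ℝ] ℝ := (innerₗ _).compl₁₂ (KG ∘ₗ ιM) (G ∘ₗ ιM)
  let gr : M →ₗ[ℝ] ℝ := innerₗ _ (hKgmem.toLp _) ∘ₗ G ∘ₗ ιM
  let lf : V →ₗ[ℝ] ℝ := innerₗ _ ((hs.f_memLp t ht).toLp _) ∘ₗ W ∘ₗ ιV +
    innerₗ _ (MemLp.toLp _ (hs.f1_memLp t ht)) ∘ₗ W' ∘ₗ ιV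
  let lφ : M →ₗ[ℝ] ℝ := innerₗ _ ((hs.phi_memLp t ht).toLp _) ∘ₗ Q ∘ₗ ιM +
    innerₗ _ (MemLp.toLp _ (hs.phi1_memLp t ht)) ∘ₗ Q' ∘ₗ ιM
  have hb : ∀ (v : V) (q : M), b v q = ∫ x in Ω, (q : E d → ℝ) x * divg (v : E d → E d) x := by
    intro v q
    have h1 : D (ιV v) =ᵐ[volume.restrict Ω] divg (v : E d → E d) :=
      (hD (ιV v)).trans (Filter.Eventually.of_forall fun x => divL_fderiv _ _)
    refine (L2_inner_eq_integral h1 (hQ (ιM q))).trans (integral_congr_ae ?_)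
    exact Filter.Eventually.of_forall fun x => (real_inner_eq_mul _ _).trans (mul_comm _ _)
  have hmass : ∀ p q : M, mass p q = ∫ x in Ω, (p : E d → ℝ) x * (q : E d → ℝ) x := by
    intro p q
    refine (L2_inner_eq_integral (hQ (ιM p)) (hQ (ιM q))).trans (integral_congr_ae ?_)
    exact Filter.Eventually.of_forall fun x => real_inner_eq_mul _ _
  have hdot : ∀ y z : Fin d → ℝ, inner ℝ (WithLp.toLp 2 y : E d) (WithLp.toLp 2 z) = y ⬝ᵥ z :=
    fun y z => by
      simp [PiLp.inner_apply, dotProduct, mul_comm]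
  have hGae : ∀ q : M, G (ιM q) =ᵐ[volume.restrict Ω]
      fun x => (WithLp.toLp 2 (grad (q : E d → ℝ) x) : E d) := fun q => hG (ιM q)
  have hstiff : ∀ p q : M, stiff p q - m.rhof * gr q = ∫ x in Ω, (m.K x).mulVec
      (grad (p : E d → ℝ) x - m.rhof • fun i => m.g x i) ⬝ᵥ grad (q : E d → ℝ) x := by
    intro p q
    have h1 : stiff p q - m.rhof * gr q =
        inner ℝ (KG (ιM p) - m.rhof • hKgmem.toLp _) (G (ιM q)) := by
      rw [inner_sub_left, real_inner_smul_left]; rfl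
    have h2 : KG (ιM p) - m.rhof • hKgmem.toLp _ =ᵐ[volume.restrict Ω]
        fun x => (WithLp.toLp 2 ((m.K x).mulVec
          (grad (p : E d → ℝ) x - m.rhof • fun i => m.g x i)) : E d) := by
      filter_upwards [Lp.coeFn_sub (KG (ιM p)) (m.rhof • hKgmem.toLp _), hKG (ιM p),
        Lp.coeFn_smul m.rhof (hKgmem.toLp _), hKgmem.coeFn_toLp] with x e1 e2 e3 e4
      rw [e1, Pi.sub_apply, e2, e3, Pi.smul_apply, e4, Matrix.mulVec_sub, Matrix.mulVec_smul]
      rfl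
    rw [h1, L2_inner_eq_integral h2 (hGae q)]
    exact integral_congr_ae (Filter.Eventually.of_forall fun x => hdot _ _)
  have hstiff0 : ∀ q : M, 0 ≤ stiff q q := by
    intro q
    have h1 : stiff q q = ∫ x in Ω, inner ℝ
        (WithLp.toLp 2 ((m.K x).mulVec (grad (q : E d → ℝ) x)) : E d)
        (WithLp.toLp 2 (grad (q : E d → ℝ) x)) := L2_inner_eq_integral (hKG (ιM q)) (hGae q)
    obtain ⟨K₁, K₂, hK1, -, hK⟩ := hm.K_bounds
    rw [h1]
    refine integral_nonneg_of_ae ?_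
    filter_upwards [hK] with x hx
    rw [hdot]
    refine le_trans ?_ (hx _).1
    have : 0 ≤ grad (q : E d → ℝ) x ⬝ᵥ grad (q : E d → ℝ) x :=
      Finset.sum_nonneg fun i _ => mul_self_nonneg _
    positivity
  have hSae : ∀ u : V, S (ιV u) =ᵐ[volume.restrict Ω]
      fun x => toFrob (strain (u : E d → E d) x) := fun u =>
    (hS (ιV u)).trans (Filter.Eventually.of_forall fun x => strainL_fderiv _ _)
  have hstress : ∀ u v : V, inner ℝ (A ((S ∘ₗ ιV) u)) ((S ∘ₗ ιV) v) =
      ∫ x in Ω, frob (m.Nop (u : E d → E d) x) (strain (v : E d → E d) x) := by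
    intro u v
    have h1 : A ((S ∘ₗ ιV) u) =ᵐ[volume.restrict Ω] fun x => toFrob (m.Nop (u : E d → E d) x) := by
      filter_upwards [hA ((S ∘ₗ ιV) u), hSae u] with x e1 e2
      rw [e1, toFrob_Nop hd, LinearMap.comp_apply, e2]
    refine (L2_inner_eq_integral h1 (hSae v)).trans (integral_congr_ae ?_)
    exact Filter.Eventually.of_forall fun x => inner_toFrob _ _
  have hlf : ∀ v : V, lf v = (∫ x in Ω, inner ℝ (s.f t x) ((v : E d → E d) x)) +
      ∫ x, inner ℝ (s.f1 t x) ((v : E d → E d) x) ∂(surf Ω) := fun v =>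
    congrArg₂ (· + ·) (L2_inner_eq_integral (hs.f_memLp t ht).coeFn_toLp (hW (ιV v)))
      (L2_inner_eq_integral (hs.f1_memLp t ht).coeFn_toLp (hW' (ιV v)))
  have hlφ : ∀ q : M, lφ q = (∫ x in Ω, s.phi t x * (q : E d → ℝ) x) +
      ∫ x, s.phi1 t x * (q : E d → ℝ) x ∂(surf Ω) := fun q => by
    refine congrArg₂ (· + ·)
      ((L2_inner_eq_integral (hs.phi_memLp t ht).coeFn_toLp (hQ (ιM q))).trans ?_)
      ((L2_inner_eq_integral (hs.phi1_memLp t ht).coeFn_toLp (hQ' (ιM q))).trans ?_)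
    · exact integral_congr_ae (Filter.Eventually.of_forall fun x => real_inner_eq_mul _ _)
    · exact integral_congr_ae (Filter.Eventually.of_forall fun x => real_inner_eq_mul _ _)
  have hS0 : Function.Injective (S ∘ₗ ιV) := by
    rw [← LinearMap.ker_eq_bot, LinearMap.ker_eq_bot']
    intro u hu
    refine Subtype.ext (eq_zero_of_strain_eq_zero hT hΩo hΩc hΩb hΩn u.2 ?_)
    filter_upwards [hS (ιV u), (hu ▸ Lp.coeFn_zero _ 2 (volume.restrict Ω) :
      (S ∘ₗ ιV) u =ᵐ[volume.restrict Ω] 0)] with x e1 e2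
    exact e1.symm.trans e2
  have hmass0 : ∀ q : M, mass q q = 0 → q = 0 := by
    intro q hq
    have h0 : Q (ιM q) = 0 := inner_self_eq_zero.mp hq
    refine Subtype.ext (eq_zero_of_mem_feSpace hΩo (hMle q.2) ?_)
    filter_upwards [hQ (ιM q), (h0 ▸ Lp.coeFn_zero _ 2 (volume.restrict Ω) :
      Q (ιM q) =ᵐ[volume.restrict Ω] 0)] with x e1 e2
    exact e1.symm.trans e2
  have hden : 0 < m.lam * m.alpha ^ 2 + m.c0 := by
    have := hm.lam_pos
    have := hm.alpha_pos
    have := hm.c0_nonneg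
    positivity
  have hκ₂ : 0 < m.kap2 := one_div_pos.mpr hden
  have hκ₃ : 0 ≤ m.kap3 := div_nonneg (mul_nonneg hm.lam_pos.le hm.c0_nonneg) hden.le
  have hμf := hm.muf_pos
  let η₀ : M := ⟨ηold, hη⟩
  obtain ⟨⟨u, ξ, η⟩, hsol, huniq⟩ := step_forms_existsUnique (S ∘ₗ ιV) hS0 A hγ hA1 hA2 b mass stiff
    (fun q => real_inner_self_nonneg (x := Q (ιM q))) hmass0 hstiff0
    (fun q hq => Subtype.ext (eq_zero_of_forall_integral_divg_eq_zero hd hT hΩo hΩc hΩb hΩn q.2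
      fun v hv => (hb ⟨v, hv⟩ q).symm.trans (hq ⟨v, hv⟩)))
    -- The diffusion equation is multiplied by the step length; the old mass term and gravity join
    -- the sources on the right.
    (κ₁ := m.kap1) hκ₂ hκ₃ (τ := dt / m.muf) (by positivity) lf
    (mass η₀ + (dt / m.muf * m.rhof) • gr + dt • lφ) η₀ θ
  have hiff : ∀ (u : V) (ξ η : M), IsStepSolution m s Ω T θ dt t ηold u ξ η ↔
      (∀ v, inner ℝ (A ((S ∘ₗ ιV) u)) ((S ∘ₗ ιV) v) - b v ξ = lf v) ∧
      (∀ φ, m.kap3 * mass ξ φ + b u φ = m.kap1 * mass (if θ = 0 then η₀ else η) φ) ∧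
      ∀ ψ, mass η ψ + dt / m.muf * stiff (m.kap1 • ξ + m.kap2 • η) ψ =
        (mass η₀ + (dt / m.muf * m.rhof) • gr + dt • lφ) ψ := by
    intro u ξ η
    have hdiff : ∀ ψ : M, ((∫ x in Ω, ((η : E d → ℝ) x - ηold x) / dt * (ψ : E d → ℝ) x) +
        1 / m.muf * (∫ x in Ω, (m.K x).mulVec
          (grad (fun y => m.kap1 * (ξ : E d → ℝ) y + m.kap2 * (η : E d → ℝ) y) x -
            m.rhof • fun i => m.g x i) ⬝ᵥ grad (ψ : E d → ℝ) x) =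
        (∫ x in Ω, s.phi t x * (ψ : E d → ℝ) x) + ∫ x, s.phi1 t x * (ψ : E d → ℝ) x ∂(surf Ω)) ↔
        mass η ψ + dt / m.muf * stiff (m.kap1 • ξ + m.kap2 • η) ψ =
          (mass η₀ + (dt / m.muf * m.rhof) • gr + dt • lφ) ψ := by
      intro ψ
      have h1 : ∫ x in Ω, ((η : E d → ℝ) x - ηold x) / dt * (ψ : E d → ℝ) x =
          (1 / dt) * (mass η ψ - mass η₀ ψ) := by
        rw [← LinearMap.sub_apply, ← map_sub, hmass, ← integral_const_mul]
        refine integral_congr_ae (Filter.Eventually.of_forall fun x => ?_)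
        change _ = 1 / dt * (((η : E d → ℝ) x - ηold x) * (ψ : E d → ℝ) x)
        ring
      have h2 := hstiff (m.kap1 • ξ + m.kap2 • η) ψ
      rw [h1, ← hlφ]
      refine (Eq.congr_left (congrArg (_ + 1 / m.muf * ·) h2.symm)).trans ?_
      simp only [LinearMap.add_apply, LinearMap.smul_apply, smul_eq_mul]
      field_simp
      constructor <;> intro h <;> linarith
    constructor
    · intro h
      refine ⟨fun v => ?_, fun φ => ?_, fun ψ => (hdiff ψ).mp (h.diffusion ψ ψ.2)⟩
      · rw [hstress, hb, hlf]
        exact h.momentum v v.2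
      · have := h.constraint φ φ.2
        rw [hmass, hmass, hb]
        simp only [mul_comm ((φ : E d → ℝ) _)]
        rw [this]
        split_ifs <;> rfl
    · rintro ⟨h1, h2, h3⟩
      refine ⟨u.2, ξ.2, η.2, fun v hv => ?_, fun φ hφ => ?_,
        fun ψ hψ => (hdiff ⟨ψ, hψ⟩).mpr (h3 ⟨ψ, hψ⟩)⟩
      · have := h1 ⟨v, hv⟩
        rwa [hstress, hb, hlf] at this
      · have := h2 ⟨φ, hφ⟩
        rw [hmass, hmass, hb] at this
        simp only [mul_comm (φ _)] at this
        rw [this]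
        split_ifs <;> rfl
  refine ⟨(u, ξ, η), (hiff u ξ η).mpr hsol, ?_⟩
  rintro ⟨u', ξ', η'⟩ h
  have := huniq (⟨u', h.u_mem⟩, ⟨ξ', h.ξ_mem⟩, ⟨η', h.η_mem⟩) ((hiff _ _ _).mp h)
  simp only [Prod.mk.injEq] at this ⊢
  exact ⟨congrArg Subtype.val this.1, congrArg Subtype.val this.2.1,
    congrArg Subtype.val this.2.2⟩

end Poro

/-! ### Iteration over the time steps. -/

/-- Unique solvability of every step determines a unique sequence for each initial value. -/
theorem existsUnique_iterate {U X W : Type*} {N : ℕ} (P : Fin N → W → U → X → W → Prop)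
    (C : W → Prop) (hC : ∀ n a u x b, P n a u x b → C b)
    (hP : ∀ n a, C a → ∃! w : U × X × W, P n a w.1 w.2.1 w.2.2) {a₀ : W} (ha₀ : C a₀) :
    ∃! w : (Fin N → U) × (Fin N → X) × (Fin (N + 1) → W),
      w.2.2 0 = a₀ ∧ ∀ n : Fin N, P n (w.2.2 n.castSucc) (w.1 n) (w.2.1 n) (w.2.2 n.succ) := by
  have hstep : ∀ (n : Fin N) (a : {a // C a}), ∃ w : U × X × {a // C a}, P n a w.1 w.2.1 w.2.2 :=
    fun n a => by
      obtain ⟨w, hw, -⟩ := hP n a a.2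
      exact ⟨(w.1, w.2.1, ⟨w.2.2, hC _ _ _ _ _ hw⟩), hw⟩
  choose F hF using hstep
  -- The invariant `C` is carried along, because a step is solvable only from an admissible value.
  let seq : Fin (N + 1) → {a // C a} := Fin.induction ⟨a₀, ha₀⟩ fun n a => (F n a).2.2
  have hseq : ∀ n : Fin N, seq n.succ = (F n (seq n.castSucc)).2.2 := fun n =>
    Fin.induction_succ _ _ n
  refine ⟨(fun n => (F n (seq n.castSucc)).1, fun n => (F n (seq n.castSucc)).2.1,
    fun n => seq n), ⟨rfl, fun n => ?_⟩, ?_⟩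
  · simp only [hseq]
    exact hF n _
  · rintro ⟨u, x, b⟩ ⟨h0, h⟩
    simp only at h0 h
    have hb : ∀ n, b n = seq n := by
      intro n
      induction n using Fin.induction with
      | zero => exact h0
      | succ n ih =>
        have h1 := h n
        rw [ih] at h1
        have := (hP n _ (seq n.castSucc).2).unique (y₁ := (u n, x n, b n.succ))
          (y₂ := ((F n (seq n.castSucc)).1, (F n (seq n.castSucc)).2.1,
            ((F n (seq n.castSucc)).2.2 : W))) h1 (hF n _)
        rw [hseq]
        exact congrArg (fun w => w.2.2) this
    have hux : ∀ n, u n = (F n (seq n.castSucc)).1 ∧ x n = (F n (seq n.castSucc)).2.1 := by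
      intro n
      have h1 := h n
      rw [hb n.castSucc] at h1
      have := (hP n _ (seq n.castSucc).2).unique (y₁ := (u n, x n, b n.succ))
        (y₂ := ((F n (seq n.castSucc)).1, (F n (seq n.castSucc)).2.1,
          ((F n (seq n.castSucc)).2.2 : W))) h1 (hF n _)
      exact ⟨congrArg (fun w => w.1) this, congrArg (fun w => w.2.1) this⟩
    simp only [Prod.mk.injEq]
    exact ⟨funext fun n => (hux n).1, funext fun n => (hux n).2, funext hb⟩

theorem mainTheorem6 (d : ℕ) (hd : d = 2 ∨ d = 3)
    (Ω : Set (Poro.E d)) (hΩo : IsOpen Ω) (hΩc : Convex ℝ Ω) (hΩb : Bornology.IsBounded Ω)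
    (hΩn : Ω.Nonempty)
    (m : Poro.Material d) (hm : m.IsAdmissible Ω)
    (𝒯 : Finset (Finset (Poro.E d))) (h𝒯 : Poro.IsPartition Ω 𝒯)
    (T : ℝ) (hT : 0 < T) (N : ℕ) (hN : 0 < N)
    (s : Poro.Sources d) (hs : s.IsAdmissible Ω T)
    (θ : Fin 2) :
    -- every single time step is uniquely solvable, whatever the previous `η`
    (∀ n : Fin N, ∀ ηold ∈ Poro.Wh Ω 𝒯,
      ∃! w : (Poro.E d → Poro.E d) × (Poro.E d → ℝ) × (Poro.E d → ℝ),
        Poro.IsStepSolution m s Ω 𝒯 θ (T / N) (((n : ℕ) + 1 : ℝ) * (T / N)) ηold w.1 w.2.1 w.2.2) ∧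
    -- the whole numerical solution exists uniquely for every starting value `η⁰`;
    -- `w.1 n`, `w.2.1 n` are `u^{n+1}`, `ξ^{n+1}` and `w.2.2 j` is `η^j`
    (∀ η₀ ∈ Poro.Wh Ω 𝒯,
      ∃! w : (Fin N → Poro.E d → Poro.E d) × (Fin N → Poro.E d → ℝ) ×
          (Fin (N + 1) → Poro.E d → ℝ),
        w.2.2 0 = η₀ ∧ ∀ n : Fin N,
          Poro.IsStepSolution m s Ω 𝒯 θ (T / N) (((n : ℕ) + 1 : ℝ) * (T / N))
            (w.2.2 n.castSucc) (w.1 n) (w.2.1 n) (w.2.2 n.succ)) := by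
  have hd0 : 0 < d := by rcases hd with rfl | rfl <;> norm_num
  have hN' : (0 : ℝ) < N := by exact_mod_cast hN
  have hstep : ∀ n : Fin N, ∀ ηold ∈ Poro.Wh Ω 𝒯,
      ∃! w : (Poro.E d → Poro.E d) × (Poro.E d → ℝ) × (Poro.E d → ℝ),
        Poro.IsStepSolution m s Ω 𝒯 θ (T / N) (((n : ℕ) + 1 : ℝ) * (T / N)) ηold
          w.1 w.2.1 w.2.2 := by
    intro n ηold hη
    -- The new time level `(n + 1) T / N` must lie in `(0, T]`, where the sources are square
    -- integrable.
    have hn : ((n : ℕ) + 1 : ℝ) ≤ N := by exact_mod_cast n.2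
    refine Poro.existsUnique_isStepSolution hd0 hΩo hΩc hΩb hΩn hm h𝒯.1.cover hs θ
      (by positivity) ⟨by positivity, ?_⟩ hη
    calc ((n : ℕ) + 1 : ℝ) * (T / N) ≤ N * (T / N) := by gcongr
      _ = T := by field_simp
  exact ⟨hstep, fun η₀ hη₀ => existsUnique_iterate
    (fun (n : Fin N) a u x b => Poro.IsStepSolution m s Ω 𝒯 θ (T / N)
      (((n : ℕ) + 1 : ℝ) * (T / N)) a u x b)
    (fun a => a ∈ Poro.Wh Ω 𝒯) (fun _ _ _ _ _ h => h.η_mem) hstep hη₀⟩
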